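/- Let $T_1<T_2$, let $p,q,m,n$ be continuous real functions on $[T_1,T_2]$ with $p>0$ and $q\ge 0$, and let $u^{\pm}=\max\{\pm u,0\}$ (likewise $m^\pm$, $n^\pm$). For $(a,b)\in\mathbb R^2$ consider the Neumann problem $$-[p(t)u']'+q(t)u=a\,m(t)u^+-b\,n(t)u^-\ \text{ in } ]T_1,T_2[,\qquad u'(T_1)=0=u'(T_2),$$ whose solutions are the $u\in C^1[T_1,T_2]$ with $pu'$ differentiable that satisfy it pointwise. For an integer $k\ge 0$ let $C_k^{>}$ (respectively $C_k^{<}$) be the set of $(a,b)\in\mathbb R^2$ for which this problem has a nontrivial solution $u$ with exactly $k$ zeros in $]T_1,T_2[$ and with $u(T_2)>0$ (respectively $u(T_2)<0$), and let $\Sigma^*=\bigcup_{k\ge1}(C_k^{>}\cup C_k^{<})$. Put $\mathbb R_+=[0,+\infty[$, $\mathbb R_-=\,]-\infty,0]$. Let $\epsilon_1,\epsilon_2\in\{+,-\}$ and suppose that $m^{\epsilon_1}\not\equiv0$ and $n^{\epsilon_2}\not\equiv0$ on $[T_1,T_2]$. Then either (i) for every integer $k\ge 0$, $C_k^{>}\cap(\mathbb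 R_{\epsilon_1}\times\mathbb R_{\epsilon_2})$ and $C_k^{<}\cap(\mathbb R_{\epsilon_1}\times\mathbb R_{\epsilon_2})$ are both nonempty, or (ii) there is an integer $k_0\ge0$ such that both intersections are nonempty for every $0\le k\le k_0$, exactly one of $C_{k_0+1}^{>}\cap(\mathbb R_{\epsilon_1}\times\mathbb R_{\epsilon_2})$ and $C_{k_0+1}^{<}\cap(\mathbb R_{\epsilon_1}\times\mathbb R_{\epsilon_2})$ is nonempty, and both intersections are empty for every $k\ge k_0+2$. In particular, if $m$ and $n$ both change sign (that is, $m^\pm\not\equiv0$ and $n^\pm\not\equiv0$ on $[T_1,T_2]$), then in each of the four quadrants $\mathbb R_{\epsilon_1}\times\mathbb R_{\epsilon_2}$ the set $\Sigma^*$ consists of a (nonzero) odd or an infinite number of hyperbolic like curves, namely the nonempty ones among the sets $C_k^{>}\cap(\mathbb R_{\epsilon_1}\times\mathbb R_{\epsilon_2})$ and $C_k^{<}\cap(\mathbb R_{\epsilon_1}\times\mathbb R_{\epsilon_2})$, $k\ge1$, where a set that occurs twice in this list is counted twice. Here a set $S$ is a hyperbolic like curve in $\mathbb R_{\epsilon_1}\times\mathbb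 R_{\epsilon_2}$ if there are $\alpha,\beta\ge0$ and a strictly decreasing $C^1$-diffeomorphism $f$ from $]\alpha,+\infty[$ onto $]\beta,+\infty[$ such that $S=\{(\epsilon_1 x,\epsilon_2 f(x)):x>\alpha\}$. -/

import Mathlib

open Set

noncomputable section

namespace Fucik

/-- The sign `ε ∈ {+, -}` as the real number `1` or `-1`. -/
def sgn (ε : ℤˣ) : ℝ := ((ε : ℤ) : ℝ)

/-- `x^+ = max {x, 0}` for `ε = 1` and `x^- = max {-x, 0}` for `ε = -1`. -/
def part (ε : ℤˣ) (x : ℝ) : ℝ := max (sgn ε * x) 0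

/-- The closed quadrant `ℝ_{ε₁} × ℝ_{ε₂}`. -/
def quadrant (ε₁ ε₂ : ℤˣ) : Set (ℝ × ℝ) :=
  {x | 0 ≤ sgn ε₁ * x.1 ∧ 0 ≤ sgn ε₂ * x.2}

/-- `w^ε ≢ 0` on `[T₁, T₂]`. -/
def PartNonzero (T₁ T₂ : ℝ) (w : ℝ → ℝ) (ε : ℤˣ) : Prop :=
  ∃ t ∈ Icc T₁ T₂, part ε (w t) ≠ 0

/-- `w` changes sign in `[T₁, T₂]`: both `w^+ ≢ 0` and `w^- ≢ 0` there. -/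
def ChangesSign (T₁ T₂ : ℝ) (w : ℝ → ℝ) : Prop :=
  PartNonzero T₁ T₂ w 1 ∧ PartNonzero T₁ T₂ w (-1)

/-- Classical solutions of `-(p u')' + q u = a m u^+ - b n u^-` in `]T₁, T₂[`,
`u'(T₁) = 0 = u'(T₂)`: `u` is `C¹` on `[T₁, T₂]` (one-sided derivatives at the ends), and the
equation holds pointwise, the differentiability of `p u'` being part of the requirement. -/
structure IsSolution (T₁ T₂ : ℝ) (p q m n : ℝ → ℝ) (a b : ℝ) (u : ℝ → ℝ) : Prop where
  contDiffOn : ContDiffOn ℝ 1 u (Icc T₁ T₂)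
  equation : ∀ t ∈ Ioo T₁ T₂,
    HasDerivAt (fun s => p s * derivWithin u (Icc T₁ T₂) s)
      (q t * u t - (a * m t * part 1 (u t) - b * n t * part (-1) (u t))) t
  neumann_left : derivWithin u (Icc T₁ T₂) T₁ = 0
  neumann_right : derivWithin u (Icc T₁ T₂) T₂ = 0

/-- The set `C_k^>` (for `σ = 1`) or `C_k^<` (for `σ = -1`): those `(a, b)` for which there is a
(nontrivial) solution with exactly `k` zeros in `]T₁, T₂[` and with `u(T₂) > 0`, respectively
`u(T₂) < 0`. -/
def C (T₁ T₂ : ℝ) (p q m n : ℝ → ℝ) (k : ℕ) (σ : ℤˣ) : Set (ℝ × ℝ) :=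
  {x | ∃ u : ℝ → ℝ, IsSolution T₁ T₂ p q m n x.1 x.2 u ∧
    {t ∈ Ioo T₁ T₂ | u t = 0}.encard = (k : ℕ∞) ∧ 0 < sgn σ * u T₂}

/-- `Σ* = ⋃_{k ≥ 1} (C_k^> ∪ C_k^<)`. -/
def SigmaStar (T₁ T₂ : ℝ) (p q m n : ℝ → ℝ) : Set (ℝ × ℝ) :=
  ⋃ k ∈ Ici (1 : ℕ), (C T₁ T₂ p q m n k 1 ∪ C T₁ T₂ p q m n k (-1))

/-- `C_k^σ` meets the quadrant `ℝ_{ε₁} × ℝ_{ε₂}`. -/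
def Meets (T₁ T₂ : ℝ) (p q m n : ℝ → ℝ) (ε₁ ε₂ : ℤˣ) (k : ℕ) (σ : ℤˣ) : Prop :=
  (C T₁ T₂ p q m n k σ ∩ quadrant ε₁ ε₂).Nonempty

/-- The labels `(k, σ)`, `k ≥ 1`, of the `C_k^σ` that meet the quadrant. Counting labels instead
of sets counts a double curve twice. -/
def curveLabels (T₁ T₂ : ℝ) (p q m n : ℝ → ℝ) (ε₁ ε₂ : ℤˣ) : Set (ℕ × ℤˣ) :=
  {i | 1 ≤ i.1 ∧ Meets T₁ T₂ p q m n ε₁ ε₂ i.1 i.2}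

/-- A hyperbolic like curve (of class `C¹`) in the quadrant `ℝ_{ε₁} × ℝ_{ε₂}`: up to the
reflection that carries this quadrant to `ℝ_+ × ℝ_+`, it is the graph of a strictly decreasing
`C¹`-diffeomorphism `f : ]α, +∞[ → ]β, +∞[`, where `α, β ≥ 0`; `g` is the inverse of `f`. -/
def IsHyperbolicLike (ε₁ ε₂ : ℤˣ) (S : Set (ℝ × ℝ)) : Prop :=
  ∃ α β : ℝ, 0 ≤ α ∧ 0 ≤ β ∧ ∃ f g : ℝ → ℝ,
    ContDiffOn ℝ 1 f (Ioi α) ∧ ContDiffOn ℝ 1 g (Ioi β) ∧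
    MapsTo f (Ioi α) (Ioi β) ∧ MapsTo g (Ioi β) (Ioi α) ∧ InvOn g f (Ioi α) (Ioi β) ∧
    StrictAntiOn f (Ioi α) ∧
    S = {x | α < sgn ε₁ * x.1 ∧ sgn ε₂ * x.2 = f (sgn ε₁ * x.1)}

end Fucik

end

noncomputable section

namespace Fucik

open Filter Topology MeasureTheory intervalIntegral

/-! Write a solution in Prüfer form, `u = R cos θ`, `p u' = -R sin θ`. The equation is positively
homogeneous, so `θ` obeys a first order equation without `R`: while `u` has the sign `τ`, `θ' = α
sin² θ + (x τ * w τ - q) cos² θ`, with `α = 1 / p`. The signs of the quadrant are absorbed into the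
weights `w`, so that the parameters `x` are nonnegative. At a zero of `u` one has `θ' = α > 0`,
hence `θ` crosses every level `π / 2 + i π` upwards and at most once. Therefore the solutions
counted by `C` with `k` zeros correspond to the angles that start at `0` or `π` and gain exactly `k
π` (`mem_C_iff`).

Nonemptiness. Since `q ≥ 0`, the angle cannot rise through a multiple of `π` where the weight of the
corresponding sign is nonpositive (`Coeffs.exists_pos_weight`). A gain of `k π` with `k ≥ 1` thus
forces `k + 1` increasing points at which the two signed weights are positive in alternation
(`Coeffs.exists_alternates`). Conversely, large equal parameters push the angle past one more level
near each such point (`Coeffs.exists_lt_angle`), and the intermediate value theorem along the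
diagonal produces the exact gain. So `meets_iff` turns the alternative into combinatorics of
alternating chains: a chain can be shortened at either end, and of two chains of equal length with
opposite final signs, one can be prolonged by the last point of the other.

Shape. Let `F` be the final angle minus its target. The difference of two angles solves a linear
equation, which gives an exact formula for the increments of `F` with continuous coefficients
(`Coeffs.angle_sub_angle`). At a zero of `F` each coefficient, times its parameter, is the Dirichlet
energy of the part of `u` of one sign, hence positive (`Coeffs.mul_incr_pos`). So `F` increases
through its zeros in each variable, and it is negative on the axes (`Coeffs.angle_lt_of_eq_zero`).
This makes the zero set, if nonempty, the graph of a decreasing `C¹` diffeomorphism between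
half-lines (`IncreasingAtZeros.isHyperbolicLike`). -/

lemma sgn_one : sgn 1 = 1 := by simp [sgn]

lemma sgn_neg (τ : ℤˣ) : sgn (-τ) = -sgn τ := by simp [sgn]

lemma sgn_neg_one : sgn (-1) = -1 := by simp [sgn]

lemma sgn_mul (σ τ : ℤˣ) : sgn (σ * τ) = sgn σ * sgn τ := by simp [sgn]

lemma sgn_mul_self (τ : ℤˣ) : sgn τ * sgn τ = 1 := by
  rcases Int.units_eq_one_or τ with rfl | rfl <;> simp [sgn]

lemma abs_sgn (τ : ℤˣ) : |sgn τ| = 1 := by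
  rcases Int.units_eq_one_or τ with rfl | rfl <;> simp [sgn]

/-! ### Positive and negative parts, squared and composed with the cosine. -/

lemma part_nonneg (τ : ℤˣ) (x : ℝ) : 0 ≤ part τ x := le_max_right _ _

lemma part_of_nonneg {τ : ℤˣ} {x : ℝ} (h : 0 ≤ sgn τ * x) : part τ x = sgn τ * x := max_eq_left h

lemma part_of_nonpos {τ : ℤˣ} {x : ℝ} (h : sgn τ * x ≤ 0) : part τ x = 0 := max_eq_right h

lemma part_sub_part (x : ℝ) : part 1 x - part (-1) x = x := by
  simp only [part, sgn_one, sgn_neg_one]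
  rcases le_total 0 x with h | h
  · rw [max_eq_left (by linarith), max_eq_right (by linarith)]; ring
  · rw [max_eq_right (by linarith), max_eq_left (by linarith)]; ring

lemma part_mul_part (x : ℝ) : part 1 x * part (-1) x = 0 := by
  simp only [part, sgn_one, sgn_neg_one]
  rcases le_total 0 x with h | h
  · rw [max_eq_right (a := -1 * x) (by linarith)]; ring
  · rw [max_eq_right (a := 1 * x) (by linarith)]; ring

lemma part_mul_of_nonneg {c : ℝ} (hc : 0 ≤ c) (τ : ℤˣ) (x : ℝ) :
    part τ (c * x) = c * part τ x := by
  rw [part, part, mul_max_of_nonneg _ _ hc, mul_zero]; congr 1; ring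

lemma continuous_part (τ : ℤˣ) : Continuous (part τ) := by
  unfold part; fun_prop

lemma abs_part_sub_part_le (τ : ℤˣ) (x y : ℝ) : |part τ x - part τ y| ≤ |x - y| := by
  refine (abs_max_sub_max_le_abs _ _ _).trans ?_
  rw [← mul_sub, abs_mul, abs_sgn, one_mul]

/-- Squaring removes the corner at `0`, since the square of the part is dominated by `y ^ 2`. This
is what makes the Prüfer field differentiable in the angle. -/
lemma hasDerivAt_part_sq (τ : ℤˣ) (x : ℝ) :
    HasDerivAt (fun y => part τ y ^ 2) (2 * part τ x * sgn τ) x := by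
  rcases lt_trichotomy (sgn τ * x) 0 with h | h | h
  · rw [part_of_nonpos h.le]
    have : (fun y => part τ y ^ 2) =ᶠ[𝓝 x] fun _ => 0 := by
      filter_upwards [(continuous_const.mul continuous_id).continuousAt.eventually_lt
        continuousAt_const h] with y hy
      rw [part_of_nonpos (show sgn τ * y ≤ 0 from le_of_lt hy)]; norm_num
    simpa using (hasDerivAt_const x (0 : ℝ)).congr_of_eventuallyEq this
  · have hx : x = 0 := by
      have := sgn_mul_self τ
      calc x = sgn τ * (sgn τ * x) := by rw [← mul_assoc, this, one_mul]
        _ = 0 := by rw [h, mul_zero]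
    subst hx
    have h0 : part τ 0 = 0 := by simp [part]
    rw [h0]
    have h1 : HasDerivAt (fun y : ℝ => y ^ 2) (2 * 0) 0 := by
      simpa using hasDerivAt_pow 2 (0 : ℝ)
    rw [hasDerivAt_iff_isLittleO] at h1 ⊢
    refine Asymptotics.IsBigO.trans_isLittleO (Asymptotics.IsBigO.of_bound 1 ?_) h1
    filter_upwards with y
    have : |part τ y - part τ 0| ≤ |y - 0| := abs_part_sub_part_le τ y 0
    rw [h0, sub_zero, sub_zero] at this
    simp only [h0, mul_zero, zero_mul, smul_zero, sub_zero, Real.norm_eq_abs, one_mul, ne_eq,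
      OfNat.ofNat_ne_zero, not_false_eq_true, zero_pow, abs_pow]
    gcongr
  · rw [part_of_nonneg h.le]
    have : (fun y => part τ y ^ 2) =ᶠ[𝓝 x] fun y => (sgn τ * y) ^ 2 := by
      filter_upwards [continuousAt_const.eventually_lt
        (continuous_const.mul continuous_id).continuousAt h] with y hy
      rw [part_of_nonneg (show 0 ≤ sgn τ * y from le_of_lt hy)]
    refine HasDerivAt.congr_of_eventuallyEq ?_ this
    exact (((hasDerivAt_id x).const_mul (sgn τ)).pow 2).congr_deriv (by simp)

/-- The square of the part of sign `τ` of the cosine. -/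
def cosSq (τ : ℤˣ) (θ : ℝ) : ℝ := part τ (Real.cos θ) ^ 2

/-- The derivative of `cosSq τ`. -/
def cosSqDeriv (τ : ℤˣ) (θ : ℝ) : ℝ := 2 * part τ (Real.cos θ) * sgn τ * -Real.sin θ

lemma hasDerivAt_cosSq (τ : ℤˣ) (θ : ℝ) : HasDerivAt (cosSq τ) (cosSqDeriv τ θ) θ :=
  (hasDerivAt_part_sq τ (Real.cos θ)).comp θ (Real.hasDerivAt_cos θ)

@[fun_prop]
lemma continuous_cosSq (τ : ℤˣ) : Continuous (cosSq τ) :=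
  ((continuous_part τ).comp Real.continuous_cos).pow 2

@[fun_prop]
lemma continuous_cosSqDeriv (τ : ℤˣ) : Continuous (cosSqDeriv τ) := by
  have := (continuous_part τ).comp Real.continuous_cos
  unfold cosSqDeriv
  exact ((continuous_const.mul this).mul continuous_const).mul Real.continuous_sin.neg

lemma cosSq_nonneg (τ : ℤˣ) (θ : ℝ) : 0 ≤ cosSq τ θ := sq_nonneg _

lemma cosSq_add_cosSq (θ : ℝ) : cosSq 1 θ + cosSq (-1) θ = Real.cos θ ^ 2 := by
  have h1 := part_sub_part (Real.cos θ)
  have h2 := part_mul_part (Real.cos θ)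
  unfold cosSq
  calc _ = (part 1 (Real.cos θ) - part (-1) (Real.cos θ)) ^ 2
        + 2 * (part 1 (Real.cos θ) * part (-1) (Real.cos θ)) := by ring
    _ = _ := by rw [h1, h2]; ring

lemma cosSq_le_one (τ : ℤˣ) (θ : ℝ) : cosSq τ θ ≤ 1 := by
  have h := cosSq_add_cosSq θ
  have h1 := cosSq_nonneg 1 θ
  have h2 := cosSq_nonneg (-1) θ
  have h3 := Real.cos_sq_le_one θ
  rcases Int.units_eq_one_or τ with rfl | rfl <;> linarith

lemma abs_cosSqDeriv_le (τ : ℤˣ) (θ : ℝ) : |cosSqDeriv τ θ| ≤ 2 := by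
  have h1 : part τ (Real.cos θ) ≤ 1 := by
    have := cosSq_le_one τ θ
    unfold cosSq at this
    nlinarith [part_nonneg τ (Real.cos θ)]
  have h2 := Real.abs_sin_le_one θ
  unfold cosSqDeriv
  rw [abs_mul, abs_mul, abs_mul, abs_sgn, abs_neg, abs_of_nonneg (part_nonneg _ _), abs_two]
  nlinarith [part_nonneg τ (Real.cos θ), abs_nonneg (Real.sin θ)]

lemma cosSq_of_cos_eq_zero {τ : ℤˣ} {θ : ℝ} (h : Real.cos θ = 0) : cosSq τ θ = 0 := by
  simp [cosSq, part, h]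

lemma abs_cosSq_sub_le (τ : ℤˣ) (x y : ℝ) : |cosSq τ y - cosSq τ x| ≤ 2 * |y - x| := by
  have := Convex.norm_image_sub_le_of_norm_hasDerivWithin_le (f := cosSq τ) (s := univ)
    (f' := cosSqDeriv τ) (C := 2) (fun x _ => (hasDerivAt_cosSq τ x).hasDerivWithinAt)
    (fun x _ => abs_cosSqDeriv_le τ x) convex_univ (mem_univ x) (mem_univ y)
  simpa using this

/-- The continuous extension of the difference quotient of `cosSq τ`. -/
def cosSqSlope (τ : ℤˣ) (x y : ℝ) : ℝ := ∫ s in (0 : ℝ)..1, cosSqDeriv τ (x + s * (y - x))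

lemma cosSqSlope_mul (τ : ℤˣ) (x y : ℝ) :
    cosSqSlope τ x y * (y - x) = cosSq τ y - cosSq τ x := by
  have h : ∀ s ∈ uIcc (0 : ℝ) 1, HasDerivAt (fun s => cosSq τ (x + s * (y - x)))
      (cosSqDeriv τ (x + s * (y - x)) * (y - x)) s := by
    intro s _
    have h1 : HasDerivAt (fun s => x + s * (y - x)) (y - x) s := by
      simpa using ((hasDerivAt_id s).mul_const (y - x)).const_add x
    exact (hasDerivAt_cosSq τ _).comp s h1
  have := integral_eq_sub_of_hasDerivAt h (Continuous.intervalIntegrable (by fun_prop) _ _)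
  rw [intervalIntegral.integral_mul_const] at this
  simpa [cosSqSlope] using this

lemma cosSqSlope_self (τ : ℤˣ) (x : ℝ) : cosSqSlope τ x x = cosSqDeriv τ x := by
  simp [cosSqSlope]

lemma continuous_cosSqSlope (τ : ℤˣ) : Continuous fun z : ℝ × ℝ => cosSqSlope τ z.1 z.2 := by
  unfold cosSqSlope
  apply intervalIntegral.continuous_parametric_intervalIntegral_of_continuous'
  have := continuous_cosSqDeriv τ
  unfold Function.uncurry
  fun_prop

/-! ### Scalar differential equations and inequalities. -/

/-- Variation of constants for a scalar linear differential equation with zero initial value. -/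
lemma eq_integral_of_linear {T₁ T₂ : ℝ} (hT : T₁ ≤ T₂) {A B y : ℝ → ℝ} (hA : Continuous A)
    (hB : Continuous B) (hy : ∀ t ∈ Icc T₁ T₂, HasDerivAt y (A t * y t + B t) t) (h0 : y T₁ = 0) :
    y T₂ = ∫ s in T₁..T₂, Real.exp (∫ r in s..T₂, A r) * B s := by
  have hE : ∀ t, HasDerivAt (fun t => Real.exp (∫ r in t..T₂, A r))
      (Real.exp (∫ r in t..T₂, A r) * -A t) t := fun t =>
    (integral_hasDerivAt_left (hA.intervalIntegrable _ _)
      (hA.stronglyMeasurableAtFilter _ _) hA.continuousAt).exp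
  have h : ∀ t ∈ uIcc T₁ T₂, HasDerivAt (fun t => Real.exp (∫ r in t..T₂, A r) * y t)
      (Real.exp (∫ r in t..T₂, A r) * B t) t := by
    intro t ht
    rw [uIcc_of_le hT] at ht
    exact ((hE t).mul (hy t ht)).congr_deriv (by ring)
  have hc : Continuous fun t => Real.exp (∫ r in t..T₂, A r) :=
    continuous_iff_continuousAt.2 fun t => (hE t).continuousAt
  have := integral_eq_sub_of_hasDerivAt h ((hc.mul hB).intervalIntegrable _ _)
  rw [this, h0]
  simp

/-- If `y' ≤ A y` on `[s, t]`, then `y t ≤ y s * exp (∫ A)`. -/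
lemma le_mul_exp_of_deriv_le {s t : ℝ} (hst : s ≤ t) {A y y' : ℝ → ℝ} (hA : Continuous A)
    (hy : ∀ r ∈ Icc s t, HasDerivAt y (y' r) r) (hle : ∀ r ∈ Ioo s t, y' r ≤ A r * y r) :
    y t ≤ y s * Real.exp (∫ r in s..t, A r) := by
  have hE : ∀ r, HasDerivAt (fun r => Real.exp (-∫ z in s..r, A z))
      (Real.exp (-∫ z in s..r, A z) * -A r) r := fun r =>
    (hA.integral_hasStrictDerivAt s r).hasDerivAt.neg.exp
  have h : ∀ r ∈ Icc s t, HasDerivAt (fun r => y r * Real.exp (-∫ z in s..r, A z))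
      (y' r * Real.exp (-∫ z in s..r, A z) + y r * (Real.exp (-∫ z in s..r, A z) * -A r)) r :=
    fun r hr => (hy r hr).mul (hE r)
  have hanti : AntitoneOn (fun r => y r * Real.exp (-∫ z in s..r, A z)) (Icc s t) := by
    apply antitoneOn_of_deriv_nonpos (convex_Icc s t)
      (fun r hr => (h r hr).continuousAt.continuousWithinAt)
    · intro r hr
      rw [interior_Icc] at hr
      exact (h r (Ioo_subset_Icc_self hr)).differentiableAt.differentiableWithinAt
    · intro r hr
      rw [interior_Icc] at hr
      rw [(h r (Ioo_subset_Icc_self hr)).deriv]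
      have := hle r hr
      have := Real.exp_pos (-∫ z in s..r, A z)
      nlinarith
  have := hanti (left_mem_Icc.2 hst) (right_mem_Icc.2 hst) hst
  simp only [integral_same, neg_zero, Real.exp_zero, mul_one] at this
  rw [Real.exp_neg, ← div_eq_mul_inv, div_le_iff₀ (Real.exp_pos _)] at this
  exact this

/-- A function whose derivative is positive wherever it takes the value `c` stays above `c`. -/
lemma lt_of_deriv_pos {s t c : ℝ} {f f' : ℝ → ℝ} (hf : ∀ r ∈ Icc s t, HasDerivAt f (f' r) r)
    (hpos : ∀ r ∈ Icc s t, f r = c → 0 < f' r) (hs : c ≤ f s) (hst : s < t) : c < f t := by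
  have hge : ∀ ⦃r⦄, r ∈ Icc s t → c ≤ f r :=
    image_le_of_deriv_right_lt_deriv_boundary' (f := fun _ => c) (f' := fun _ => 0)
      continuousOn_const (fun r _ => hasDerivWithinAt_const _ _ _) hs
      (fun r hr => (hf r hr).continuousAt.continuousWithinAt)
      (fun r hr => (hf r (Ico_subset_Icc_self hr)).hasDerivWithinAt)
      (fun r hr h => hpos r (Ico_subset_Icc_self hr) h.symm)
  have ht : t ∈ Icc s t := right_mem_Icc.2 hst.le
  refine lt_of_le_of_ne (hge ht) fun h => ?_
  have hd := hpos t ht h.symm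
  have hmin : ∀ᶠ r in 𝓝[<] t, f t ≤ f r := by
    filter_upwards [Ioo_mem_nhdsLT hst] with r hr
    rw [← h]; exact hge ⟨hr.1.le, hr.2.le⟩
  have hslope := ((hasDerivAt_iff_tendsto_slope.1 (hf t ht)).mono_left
    (nhdsWithin_mono t (fun r (hr : r < t) => hr.ne))).eventually_const_lt hd
  obtain ⟨r, h1, h2, h3⟩ := (hmin.and (hslope.and self_mem_nhdsWithin)).exists
  rw [slope_def_field] at h2
  have h3' : r - t < 0 := sub_neg.2 h3
  have := div_nonpos_of_nonneg_of_nonpos (sub_nonneg.2 h1) h3'.le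
  linarith

/-! ### The Prüfer angle and its dependence on the parameters. -/

/-- The coefficients of the problem, extended continuously to the line: `α = 1 / p`, and `w τ` is
the weight on the set where the solution has the sign `τ`. -/
structure Coeffs where
  T₁ : ℝ
  T₂ : ℝ
  α : ℝ → ℝ
  q : ℝ → ℝ
  w : ℤˣ → ℝ → ℝ
  lt : T₁ < T₂
  continuous_α : Continuous α
  continuous_q : Continuous q
  continuous_w : ∀ τ, Continuous (w τ)
  α_pos : ∀ t, 0 < α t
  q_nonneg : ∀ t, 0 ≤ q t

namespace Coeffs

variable (D : Coeffs)

attribute [fun_prop] continuous_α continuous_q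

/-- The coefficient of `cosSq τ` in the equation of the angle. -/
def coef (x : ℤˣ → ℝ) (τ : ℤˣ) (t : ℝ) : ℝ := x τ * D.w τ t - D.q t - D.α t

lemma continuous_coef_uncurry (τ : ℤˣ) :
    Continuous fun z : (ℤˣ → ℝ) × ℝ => D.coef z.1 τ z.2 := by
  have := D.continuous_w τ
  unfold coef
  fun_prop

lemma continuous_coef (x : ℤˣ → ℝ) (τ : ℤˣ) : Continuous (D.coef x τ) :=
  (D.continuous_coef_uncurry τ).comp (Continuous.prodMk_right x)

/-- The right-hand side of the differential equation of the Prüfer angle. -/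
def field (x : ℤˣ → ℝ) (t θ : ℝ) : ℝ :=
  D.α t + D.coef x 1 t * cosSq 1 θ + D.coef x (-1) t * cosSq (-1) θ

lemma continuous_field (x : ℤˣ → ℝ) : Continuous fun z : ℝ × ℝ => D.field x z.1 z.2 := by
  have := D.continuous_coef x
  unfold field
  fun_prop

lemma field_of_cos_eq_zero (x : ℤˣ → ℝ) (t : ℝ) {θ : ℝ} (h : Real.cos θ = 0) :
    D.field x t θ = D.α t := by
  simp [field, cosSq_of_cos_eq_zero h]

lemma exists_bound (x : ℤˣ → ℝ) : ∃ K : ℝ, 0 ≤ K ∧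
    ∀ t ∈ Icc D.T₁ D.T₂, |D.α t| ≤ K ∧ ∀ τ, |D.coef x τ t| ≤ K ∧ |D.w τ t| ≤ K := by
  obtain ⟨K, hK⟩ := isCompact_Icc.exists_bound_of_continuousOn (s := Icc D.T₁ D.T₂)
    (f := fun t => (D.α t, ((D.coef x 1 t, D.coef x (-1) t), (D.w 1 t, D.w (-1) t))))
    (by
      have h1 := D.continuous_coef x
      have h2 := D.continuous_w
      fun_prop)
  refine ⟨max K 0, le_max_right _ _, fun t ht => ?_⟩
  have h := (hK t ht).trans (le_max_left K 0)
  simp only [Prod.norm_mk, Real.norm_eq_abs, sup_le_iff] at h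
  refine ⟨h.1, fun τ => ?_⟩
  rcases Int.units_eq_one_or τ with rfl | rfl
  exacts [⟨h.2.1.1, h.2.2.1⟩, ⟨h.2.1.2, h.2.2.2⟩]

lemma exists_lipschitz (x : ℤˣ → ℝ) :
    ∃ K : NNReal, ∀ t ∈ Icc D.T₁ D.T₂, LipschitzWith K (D.field x t) := by
  obtain ⟨K, hK0, hK⟩ := D.exists_bound x
  refine ⟨⟨4 * K, by positivity⟩, fun t ht => LipschitzWith.of_dist_le_mul fun a b => ?_⟩
  have h1 := abs_cosSq_sub_le 1 b a
  have h2 := abs_cosSq_sub_le (-1) b a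
  rw [Real.dist_eq, Real.dist_eq]
  calc |D.field x t a - D.field x t b|
      = |D.coef x 1 t * (cosSq 1 a - cosSq 1 b)
          + D.coef x (-1) t * (cosSq (-1) a - cosSq (-1) b)| := by unfold field; ring_nf
    _ ≤ |D.coef x 1 t| * |cosSq 1 a - cosSq 1 b|
          + |D.coef x (-1) t| * |cosSq (-1) a - cosSq (-1) b| := by
        rw [← abs_mul, ← abs_mul]; exact abs_add_le _ _
    _ ≤ K * (2 * |a - b|) + K * (2 * |a - b|) := by
        gcongr
        exacts [((hK t ht).2 1).1, ((hK t ht).2 (-1)).1]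
    _ = 4 * K * |a - b| := by ring

/-- The field is bounded by `3 K`, so one Picard–Lindelöf ball of radius `3 K (T₂ - T₁)` covers the
whole interval. Rewriting the solution as an integral of an extended continuous function gives
two-sided derivatives at the endpoints as well. -/
lemma exists_angle (x : ℤˣ → ℝ) (θ₀ : ℝ) : ∃ φ : ℝ → ℝ, φ D.T₁ = θ₀ ∧
    ∀ t ∈ Icc D.T₁ D.T₂, HasDerivAt φ (D.field x t (φ t)) t := by
  obtain ⟨K, hK0, hK⟩ := D.exists_bound x
  obtain ⟨L, hL⟩ := D.exists_lipschitz x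
  have hlen : 0 ≤ D.T₂ - D.T₁ := sub_nonneg.2 D.lt.le
  have hpl : IsPicardLindelof (D.field x) (tmin := D.T₁) (tmax := D.T₂)
      ⟨D.T₁, left_mem_Icc.2 D.lt.le⟩ θ₀ ⟨3 * K * (D.T₂ - D.T₁), by positivity⟩ 0
      ⟨3 * K, by positivity⟩ L := by
    refine ⟨fun t ht => (hL t ht).lipschitzOnWith, fun y _ => ?_, fun t ht y _ => ?_, ?_⟩
    · exact ((D.continuous_field x).comp (Continuous.prodMk_left y)).continuousOn
    · have h1 : |D.coef x 1 t * cosSq 1 y| ≤ K * 1 := by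
        rw [abs_mul, abs_of_nonneg (cosSq_nonneg 1 y)]
        exact mul_le_mul ((hK t ht).2 1).1 (cosSq_le_one _ _) (cosSq_nonneg _ _) hK0
      have h2 : |D.coef x (-1) t * cosSq (-1) y| ≤ K * 1 := by
        rw [abs_mul, abs_of_nonneg (cosSq_nonneg (-1) y)]
        exact mul_le_mul ((hK t ht).2 (-1)).1 (cosSq_le_one _ _) (cosSq_nonneg _ _) hK0
      rw [Real.norm_eq_abs]
      refine (abs_add_three _ _ _).trans ?_
      have := (hK t ht).1
      change _ ≤ 3 * K
      linarith
    · change 3 * K * max (D.T₂ - D.T₁) (D.T₁ - D.T₁) ≤ 3 * K * (D.T₂ - D.T₁) - 0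
      rw [sub_self, max_eq_left hlen, sub_zero]
  obtain ⟨φ, h0, hφ⟩ := hpl.exists_eq_forall_mem_Icc_hasDerivWithinAt
    (Metric.mem_closedBall_self le_rfl)
  have hc : Continuous (IccExtend D.lt.le ((Icc D.T₁ D.T₂).domRestrict φ)) :=
    (continuousOn_iff_continuous_domRestrict.1
      (fun t ht => (hφ t ht).continuousWithinAt)).Icc_extend'
  set φ₁ := IccExtend D.lt.le ((Icc D.T₁ D.T₂).domRestrict φ) with hφ₁
  have hext : ∀ t ∈ Icc D.T₁ D.T₂, φ₁ t = φ t := fun t ht => by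
    rw [hφ₁, IccExtend_of_mem _ _ ht]; rfl
  have hfc : Continuous fun s => D.field x s (φ₁ s) :=
    (D.continuous_field x).comp (continuous_id.prodMk hc)
  have hψ : ∀ t, HasDerivAt (fun t => θ₀ + ∫ s in D.T₁..t, D.field x s (φ₁ s))
      (D.field x t (φ₁ t)) t := fun t =>
    (hfc.integral_hasStrictDerivAt D.T₁ t).hasDerivAt.const_add θ₀
  have heq : ∀ t ∈ Icc D.T₁ D.T₂, θ₀ + ∫ s in D.T₁..t, D.field x s (φ₁ s) = φ t := by
    intro t ht
    have : ∫ s in D.T₁..t, D.field x s (φ₁ s) = φ t - φ D.T₁ := by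
      apply integral_eq_sub_of_hasDeriv_right_of_le ht.1
        (fun s hs => ((hφ s ⟨hs.1, hs.2.trans ht.2⟩).continuousWithinAt.mono
          (Icc_subset_Icc_right ht.2)))
      · intro s hs
        have hs' : s ∈ Icc D.T₁ D.T₂ := ⟨hs.1.le, hs.2.le.trans ht.2⟩
        rw [hext s hs']
        exact ((hφ s hs').hasDerivAt
          (Icc_mem_nhds hs.1 (hs.2.trans_le ht.2))).hasDerivWithinAt
      · exact hfc.intervalIntegrable _ _
    rw [this]
    have : φ D.T₁ = θ₀ := h0
    rw [this]; ring
  refine ⟨fun t => θ₀ + ∫ s in D.T₁..t, D.field x s (φ₁ s), by simp, fun t ht => ?_⟩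
  have := hψ t
  rw [hext t ht] at this
  simp only [heq t ht]
  exact this

/-- The Prüfer angle with initial value `θ₀`. -/
def angle (x : ℤˣ → ℝ) (θ₀ : ℝ) : ℝ → ℝ := (D.exists_angle x θ₀).choose

variable (x x' : ℤˣ → ℝ) (θ₀ : ℝ)

lemma angle_left : D.angle x θ₀ D.T₁ = θ₀ := (D.exists_angle x θ₀).choose_spec.1

lemma hasDerivAt_angle {t : ℝ} (ht : t ∈ Icc D.T₁ D.T₂) :
    HasDerivAt (D.angle x θ₀) (D.field x t (D.angle x θ₀ t)) t :=
  (D.exists_angle x θ₀).choose_spec.2 t ht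

lemma continuousOn_angle : ContinuousOn (D.angle x θ₀) (Icc D.T₁ D.T₂) := fun _ ht =>
  (D.hasDerivAt_angle x θ₀ ht).continuousAt.continuousWithinAt

lemma left_mem : D.T₁ ∈ Icc D.T₁ D.T₂ := left_mem_Icc.2 D.lt.le

lemma right_mem : D.T₂ ∈ Icc D.T₁ D.T₂ := right_mem_Icc.2 D.lt.le

/-- The Prüfer angle, extended by constants outside `[T₁, T₂]`. -/
def angleExt (x : ℤˣ → ℝ) (θ₀ t : ℝ) : ℝ := D.angle x θ₀ (projIcc D.T₁ D.T₂ D.lt.le t)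

lemma angleExt_of_mem {t : ℝ} (ht : t ∈ Icc D.T₁ D.T₂) : D.angleExt x θ₀ t = D.angle x θ₀ t := by
  rw [angleExt, projIcc_of_mem _ ht]

lemma continuous_angleExt : Continuous (D.angleExt x θ₀) :=
  (continuousOn_iff_continuous_domRestrict.1 (D.continuousOn_angle x θ₀)).Icc_extend'

/-- By Grönwall: the angle for `x'` solves the equation for `x` up to an error `2 B * dist x' x`.
The constants depend on `x` only, so the bound is uniform in `t`, which yields joint continuity. -/
lemma exists_dist_angle_le : ∃ K C : ℝ, ∀ x' : ℤˣ → ℝ, ∀ t,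
    dist (D.angleExt x' θ₀ t) (D.angleExt x θ₀ t)
      ≤ gronwallBound 0 K (C * dist x' x) (D.T₂ - D.T₁) := by
  obtain ⟨B, hB0, hB⟩ := D.exists_bound x
  obtain ⟨K, hK⟩ := D.exists_lipschitz x
  refine ⟨K, 2 * B, fun x' t => ?_⟩
  have hd : 0 ≤ 2 * B * dist x' x := by positivity
  have ht := (projIcc D.T₁ D.T₂ D.lt.le t).2
  set s : ℝ := (projIcc D.T₁ D.T₂ D.lt.le t : ℝ)
  have hx : ∀ τ, |x' τ - x τ| ≤ dist x' x := fun τ => dist_le_pi_dist x' x τ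
  have key := dist_le_of_approx_trajectories_ODE_of_mem (v := D.field x) (s := fun _ => univ)
    (f := D.angle x' θ₀) (g := D.angle x θ₀) (a := D.T₁) (b := D.T₂) (K := K) (δ := 0)
    (f' := fun t => D.field x' t (D.angle x' θ₀ t)) (g' := fun t => D.field x t (D.angle x θ₀ t))
    (εf := 2 * B * dist x' x) (εg := 0)
    (fun t ht => (hK t (Ico_subset_Icc_self ht)).lipschitzOnWith)
    (D.continuousOn_angle x' θ₀)
    (fun t ht => (D.hasDerivAt_angle x' θ₀ (Ico_subset_Icc_self ht)).hasDerivWithinAt)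
    (fun t ht => by
      set θ := D.angle x' θ₀ t
      have hb := (hB t (Ico_subset_Icc_self ht)).2
      rw [Real.dist_eq]
      calc |D.field x' t θ - D.field x t θ|
          = |(x' 1 - x 1) * D.w 1 t * cosSq 1 θ + (x' (-1) - x (-1)) * D.w (-1) t * cosSq (-1) θ| := by
            unfold field coef; ring_nf
        _ ≤ |x' 1 - x 1| * |D.w 1 t| * cosSq 1 θ
              + |x' (-1) - x (-1)| * |D.w (-1) t| * cosSq (-1) θ := by
            refine (abs_add_le _ _).trans ?_
            simp only [abs_mul, abs_of_nonneg (cosSq_nonneg _ _), le_refl]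
        _ ≤ dist x' x * B * 1 + dist x' x * B * 1 := by
            have hτ : ∀ τ, |x' τ - x τ| * |D.w τ t| * cosSq τ θ ≤ dist x' x * B * 1 := fun τ =>
              mul_le_mul (mul_le_mul (hx τ) (hb τ).2 (abs_nonneg _) dist_nonneg)
                (cosSq_le_one _ _) (cosSq_nonneg _ _) (by positivity)
            exact add_le_add (hτ 1) (hτ (-1))
        _ = 2 * B * dist x' x := by ring)
    (fun _ _ => mem_univ _) (D.continuousOn_angle x θ₀)
    (fun t ht => (D.hasDerivAt_angle x θ₀ (Ico_subset_Icc_self ht)).hasDerivWithinAt)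
    (fun t _ => by simp) (fun _ _ => mem_univ _) (by simp [D.angle_left]) s ht
  rw [add_zero] at key
  exact key.trans (gronwallBound_mono le_rfl hd K.2 (by linarith [ht.2]))

lemma continuous_angleExt_uncurry :
    Continuous fun z : (ℤˣ → ℝ) × ℝ => D.angleExt z.1 θ₀ z.2 := by
  rw [continuous_iff_continuousAt]
  rintro ⟨x, t⟩
  obtain ⟨K, C, h⟩ := D.exists_dist_angle_le x θ₀
  rw [ContinuousAt, tendsto_iff_dist_tendsto_zero]
  have h1 : Tendsto (fun z : (ℤˣ → ℝ) × ℝ => gronwallBound 0 K (C * dist z.1 x) (D.T₂ - D.T₁)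
      + dist (D.angleExt x θ₀ z.2) (D.angleExt x θ₀ t)) (𝓝 (x, t)) (𝓝 0) := by
    have hc : Continuous fun z : (ℤˣ → ℝ) × ℝ =>
        gronwallBound 0 K (C * dist z.1 x) (D.T₂ - D.T₁)
          + dist (D.angleExt x θ₀ z.2) (D.angleExt x θ₀ t) := by
      have h2 := D.continuous_angleExt x θ₀
      have h3 := gronwallBound_continuous_ε 0 K (D.T₂ - D.T₁)
      exact (h3.comp (by fun_prop)).add ((h2.comp continuous_snd).dist continuous_const)
    have := hc.tendsto (x, t)
    simpa [gronwallBound_ε0_δ0] using this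
  exact squeeze_zero (fun _ => dist_nonneg)
    (fun z => (dist_triangle _ (D.angleExt x θ₀ z.2) _).trans (by gcongr; exact h z.1 z.2)) h1

/-- The coefficient of the linear equation satisfied by the difference of two angles. -/
def slope (x x' : ℤˣ → ℝ) (θ₀ t : ℝ) : ℝ :=
  D.coef x' 1 t * cosSqSlope 1 (D.angleExt x θ₀ t) (D.angleExt x' θ₀ t)
    + D.coef x' (-1) t * cosSqSlope (-1) (D.angleExt x θ₀ t) (D.angleExt x' θ₀ t)

lemma continuous_slope_uncurry : Continuous fun z : ((ℤˣ → ℝ) × (ℤˣ → ℝ)) × ℝ =>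
    D.slope z.1.1 z.1.2 θ₀ z.2 := by
  have h1 := D.continuous_angleExt_uncurry θ₀
  have h2 : Continuous fun z : ((ℤˣ → ℝ) × (ℤˣ → ℝ)) × ℝ => D.angleExt z.1.1 θ₀ z.2 :=
    h1.comp (f := fun z : ((ℤˣ → ℝ) × (ℤˣ → ℝ)) × ℝ => (z.1.1, z.2)) (by fun_prop)
  have h3 : Continuous fun z : ((ℤˣ → ℝ) × (ℤˣ → ℝ)) × ℝ => D.angleExt z.1.2 θ₀ z.2 :=
    h1.comp (f := fun z : ((ℤˣ → ℝ) × (ℤˣ → ℝ)) × ℝ => (z.1.2, z.2)) (by fun_prop)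
  have h4 := fun τ => (continuous_cosSqSlope τ).comp (h2.prodMk h3)
  have h5 := fun τ => (D.continuous_coef_uncurry τ).comp
    (f := fun z : ((ℤˣ → ℝ) × (ℤˣ → ℝ)) × ℝ => (z.1.2, z.2)) (by fun_prop)
  exact ((h5 1).mul (h4 1)).add ((h5 (-1)).mul (h4 (-1)))

lemma continuous_slope : Continuous (D.slope x x' θ₀) :=
  (D.continuous_slope_uncurry θ₀).comp (Continuous.prodMk_right (x, x'))

/-- The factor of `x' τ - x τ` in the difference of the final angles for `x'` and `x`. -/
def incr (x x' : ℤˣ → ℝ) (θ₀ : ℝ) (τ : ℤˣ) : ℝ :=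
  ∫ s in D.T₁..D.T₂, Real.exp (∫ r in s..D.T₂, D.slope x x' θ₀ r)
    * (D.w τ s * cosSq τ (D.angleExt x θ₀ s))

lemma continuous_incr (τ : ℤˣ) :
    Continuous fun z : (ℤˣ → ℝ) × (ℤˣ → ℝ) => D.incr z.1 z.2 θ₀ τ := by
  unfold incr
  apply intervalIntegral.continuous_parametric_intervalIntegral_of_continuous'
  have h1 : Continuous fun z : ((ℤˣ → ℝ) × (ℤˣ → ℝ)) × ℝ => D.angleExt z.1.1 θ₀ z.2 :=
    (D.continuous_angleExt_uncurry θ₀).comp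
      (f := fun z : ((ℤˣ → ℝ) × (ℤˣ → ℝ)) × ℝ => (z.1.1, z.2)) (by fun_prop)
  have h2 : Continuous fun z : ((ℤˣ → ℝ) × (ℤˣ → ℝ)) × ℝ =>
      ∫ r in z.2..D.T₂, D.slope z.1.1 z.1.2 θ₀ r := by
    simp_rw [intervalIntegral.integral_symm D.T₂]
    refine (intervalIntegral.continuous_parametric_intervalIntegral_of_continuous
      (f := fun (z : ((ℤˣ → ℝ) × (ℤˣ → ℝ)) × ℝ) r => D.slope z.1.1 z.1.2 θ₀ r) ?_
      continuous_snd).neg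
    exact (D.continuous_slope_uncurry θ₀).comp
      (f := fun y : (((ℤˣ → ℝ) × (ℤˣ → ℝ)) × ℝ) × ℝ => (y.1.1, y.2)) (by fun_prop)
  have h3 := D.continuous_w τ
  unfold Function.uncurry
  exact h2.rexp.mul ((h3.comp continuous_snd).mul ((continuous_cosSq τ).comp h1))

/-- The mean value form of the field makes the difference of the angles an exact solution of a
linear equation with zero initial value. No first order approximation is involved, so derivatives in
the parameters can be read off later. -/
lemma angle_sub_angle : D.angle x' θ₀ D.T₂ - D.angle x θ₀ D.T₂
    = (x' 1 - x 1) * D.incr x x' θ₀ 1 + (x' (-1) - x (-1)) * D.incr x x' θ₀ (-1) := by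
  have hA := D.continuous_slope x x' θ₀
  have hw := D.continuous_w
  have hext := D.continuous_angleExt x θ₀
  have hB : ∀ τ, Continuous fun s => D.w τ s * cosSq τ (D.angleExt x θ₀ s) := fun τ =>
    (hw τ).mul ((continuous_cosSq τ).comp hext)
  have h := eq_integral_of_linear D.lt.le hA
    (B := fun s => (x' 1 - x 1) * (D.w 1 s * cosSq 1 (D.angleExt x θ₀ s))
      + (x' (-1) - x (-1)) * (D.w (-1) s * cosSq (-1) (D.angleExt x θ₀ s)))
    (((hB 1).const_mul _).add ((hB (-1)).const_mul _))
    (y := fun t => D.angle x' θ₀ t - D.angle x θ₀ t)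
    (fun t ht => by
      refine ((D.hasDerivAt_angle x' θ₀ ht).sub (D.hasDerivAt_angle x θ₀ ht)).congr_deriv ?_
      have h1 := fun τ => cosSqSlope_mul τ (D.angle x θ₀ t) (D.angle x' θ₀ t)
      simp only [slope, D.angleExt_of_mem _ _ ht]
      rw [add_mul, mul_assoc, mul_assoc, h1, h1]
      unfold field coef
      ring)
    (by simp [D.angle_left])
  have hE : Continuous fun s => Real.exp (∫ r in s..D.T₂, D.slope x x' θ₀ r) := by
    simp_rw [intervalIntegral.integral_symm D.T₂]
    exact (intervalIntegral.continuous_primitive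
      (fun a b => hA.intervalIntegrable a b) D.T₂).neg.rexp
  have hint : ∀ τ, IntervalIntegrable (fun s => Real.exp (∫ r in s..D.T₂, D.slope x x' θ₀ r)
      * (D.w τ s * cosSq τ (D.angleExt x θ₀ s))) volume D.T₁ D.T₂ :=
    fun τ => (hE.mul (hB τ)).intervalIntegrable _ _
  rw [h, incr, incr, ← intervalIntegral.integral_const_mul, ← intervalIntegral.integral_const_mul,
    ← intervalIntegral.integral_add ((hint 1).const_mul _) ((hint (-1)).const_mul _)]
  congr 1
  ext s
  ring

end Coeffs

/-! ### The Prüfer radius, the solutions and their zeros. -/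

namespace Coeffs

variable (D : Coeffs) (x : ℤˣ → ℝ) (θ₀ : ℝ)

/-- The first order system satisfied by `(u, p u')`. -/
def system (t : ℝ) (z : ℝ × ℝ) : ℝ × ℝ :=
  (D.α t * z.2, D.q t * z.1 - (x 1 * D.w 1 t * part 1 z.1 - x (-1) * D.w (-1) t * part (-1) z.1))

lemma exists_lipschitz_system :
    ∃ K : NNReal, ∀ t ∈ Icc D.T₁ D.T₂, LipschitzWith K (D.system x t) := by
  obtain ⟨K, hK⟩ := isCompact_Icc.exists_bound_of_continuousOn (s := Icc D.T₁ D.T₂)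
    (f := fun t => ((D.α t, D.q t), (x 1 * D.w 1 t, x (-1) * D.w (-1) t)))
    (by
      have h2 := D.continuous_w
      fun_prop)
  refine ⟨⟨3 * max K 0, by positivity⟩, fun t ht => LipschitzWith.of_dist_le_mul fun y z => ?_⟩
  have h := (hK t ht).trans (le_max_left K 0)
  have hM : 0 ≤ max K 0 := le_max_right _ _
  simp only [Prod.norm_mk, Real.norm_eq_abs, sup_le_iff] at h
  obtain ⟨⟨h1, h2⟩, h3, h4⟩ := h
  change _ ≤ 3 * max K 0 * dist y z
  set M := max K 0
  have hy1 : |y.1 - z.1| ≤ dist y z := by rw [← Real.dist_eq]; exact le_max_left _ _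
  have hy2 : |y.2 - z.2| ≤ dist y z := by rw [← Real.dist_eq]; exact le_max_right _ _
  have hp := fun τ => (abs_part_sub_part_le τ y.1 z.1).trans hy1
  rw [Prod.dist_eq]
  apply max_le
  · rw [Real.dist_eq]
    simp only [system]
    rw [← mul_sub, abs_mul]
    have := mul_le_mul h1 hy2 (abs_nonneg _) hM
    nlinarith [dist_nonneg (x := y) (y := z)]
  · rw [Real.dist_eq]
    simp only [system]
    calc _ = |D.q t * (y.1 - z.1) + -(x 1 * D.w 1 t * (part 1 y.1 - part 1 z.1))
          + x (-1) * D.w (-1) t * (part (-1) y.1 - part (-1) z.1)| := by ring_nf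
      _ ≤ M * dist y z + M * dist y z + M * dist y z := by
        refine (abs_add_three _ _ _).trans ?_
        rw [abs_neg, abs_mul, abs_mul (x 1 * D.w 1 t), abs_mul (x (-1) * D.w (-1) t)]
        exact add_le_add (add_le_add (mul_le_mul h2 hy1 (abs_nonneg _) hM)
          (mul_le_mul h3 (hp 1) (abs_nonneg _) hM)) (mul_le_mul h4 (hp (-1)) (abs_nonneg _) hM)
      _ = 3 * M * dist y z := by ring

/-- The Prüfer radius, normalized to `1` at `T₂`. -/
def radius (t : ℝ) : ℝ := Real.exp ((∫ r in t..D.T₂, D.slope x x θ₀ r) / 2)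

lemma radius_pos (t : ℝ) : 0 < D.radius x θ₀ t := Real.exp_pos _

lemma radius_right : D.radius x θ₀ D.T₂ = 1 := by simp [radius]

lemma hasDerivAt_radius (t : ℝ) :
    HasDerivAt (D.radius x θ₀) (-(D.slope x x θ₀ t / 2) * D.radius x θ₀ t) t := by
  have hA := D.continuous_slope x x θ₀
  exact ((integral_hasDerivAt_left (hA.intervalIntegrable _ _)
    (hA.stronglyMeasurableAtFilter _ _) hA.continuousAt).div_const 2).exp.congr_deriv
    (by unfold radius; ring)

lemma continuous_radius : Continuous (D.radius x θ₀) :=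
  continuous_iff_continuousAt.2 fun t => (D.hasDerivAt_radius x θ₀ t).continuousAt

/-- The solution with Prüfer angle `angle x θ₀`. -/
def sol (t : ℝ) : ℝ := D.radius x θ₀ t * Real.cos (D.angle x θ₀ t)

/-- The momentum `p u'` of the solution with Prüfer angle `angle x θ₀`. -/
def mom (t : ℝ) : ℝ := -(D.radius x θ₀ t * Real.sin (D.angle x θ₀ t))

/-- On the diagonal `slope` is the derivative of the field in the angle, and minus one half of it is
`R' / R` for the Prüfer radius. Hence the exponential kernel in `incr` is there the square of the
radius. -/
lemma slope_self {t : ℝ} (ht : t ∈ Icc D.T₁ D.T₂) : D.slope x x θ₀ t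
    = D.coef x 1 t * cosSqDeriv 1 (D.angle x θ₀ t)
      + D.coef x (-1) t * cosSqDeriv (-1) (D.angle x θ₀ t) := by
  simp [slope, cosSqSlope_self, D.angleExt_of_mem _ _ ht]

lemma hasDerivAt_sol {t : ℝ} (ht : t ∈ Icc D.T₁ D.T₂) :
    HasDerivAt (D.sol x θ₀) (D.α t * D.mom x θ₀ t) t := by
  have hφ := D.hasDerivAt_angle x θ₀ ht
  refine ((D.hasDerivAt_radius x θ₀ t).mul hφ.cos).congr_deriv ?_
  rw [slope_self _ _ _ ht]
  unfold mom field
  have h1 := part_sub_part (Real.cos (D.angle x θ₀ t))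
  have h2 := part_mul_part (Real.cos (D.angle x θ₀ t))
  simp only [cosSq, cosSqDeriv, sgn_one, sgn_neg_one]
  set P := part 1 (Real.cos (D.angle x θ₀ t))
  set N := part (-1) (Real.cos (D.angle x θ₀ t))
  rw [← h1]
  linear_combination -D.radius x θ₀ t * Real.sin (D.angle x θ₀ t)
    * (D.coef x 1 t + D.coef x (-1) t) * h2

lemma hasDerivAt_mom {t : ℝ} (ht : t ∈ Icc D.T₁ D.T₂) :
    HasDerivAt (D.mom x θ₀) (D.q t * D.sol x θ₀ t
      - (x 1 * D.w 1 t * part 1 (D.sol x θ₀ t)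
        - x (-1) * D.w (-1) t * part (-1) (D.sol x θ₀ t))) t := by
  have hφ := D.hasDerivAt_angle x θ₀ ht
  refine ((D.hasDerivAt_radius x θ₀ t).mul hφ.sin).neg.congr_deriv ?_
  rw [slope_self _ _ _ ht]
  unfold sol field
  rw [part_mul_of_nonneg (D.radius_pos x θ₀ t).le, part_mul_of_nonneg (D.radius_pos x θ₀ t).le]
  have h1 := part_sub_part (Real.cos (D.angle x θ₀ t))
  have h2 := part_mul_part (Real.cos (D.angle x θ₀ t))
  have h3 := Real.sin_sq_add_cos_sq (D.angle x θ₀ t)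
  have e1 : x 1 * D.w 1 t = D.coef x 1 t + D.q t + D.α t := by unfold coef; ring
  have e2 : x (-1) * D.w (-1) t = D.coef x (-1) t + D.q t + D.α t := by unfold coef; ring
  rw [e1, e2]
  simp only [cosSq, cosSqDeriv, sgn_one, sgn_neg_one]
  set P := part 1 (Real.cos (D.angle x θ₀ t))
  set N := part (-1) (Real.cos (D.angle x θ₀ t))
  rw [← h1] at h3 ⊢
  set R := D.radius x θ₀ t
  set s := Real.sin (D.angle x θ₀ t)
  linear_combination (R * (N * D.coef x (-1) t - P * D.coef x 1 t)) * h3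
    - R * (D.coef x 1 t + D.coef x (-1) t) * (P - N) * h2

lemma continuousOn_sol : ContinuousOn (D.sol x θ₀) (Icc D.T₁ D.T₂) := fun _ ht =>
  (D.hasDerivAt_sol x θ₀ ht).continuousAt.continuousWithinAt

lemma continuousOn_mom : ContinuousOn (D.mom x θ₀) (Icc D.T₁ D.T₂) := fun _ ht =>
  (D.hasDerivAt_mom x θ₀ ht).continuousAt.continuousWithinAt

/-- Every solution of the system with vanishing initial momentum is a multiple of a solution in
Prüfer coordinates. -/
lemma eq_mul_sol {u v : ℝ → ℝ} (hu : ContinuousOn u (Icc D.T₁ D.T₂))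
    (hv : ContinuousOn v (Icc D.T₁ D.T₂))
    (hu' : ∀ t ∈ Ico D.T₁ D.T₂, HasDerivWithinAt u (D.α t * v t) (Ici t) t)
    (hv' : ∀ t ∈ Ico D.T₁ D.T₂, HasDerivWithinAt v (D.q t * u t - (x 1 * D.w 1 t * part 1 (u t)
      - x (-1) * D.w (-1) t * part (-1) (u t))) (Ici t) t)
    (hv0 : v D.T₁ = 0) (hθ : Real.sin θ₀ = 0) (hu0 : u D.T₁ = |u D.T₁| * Real.cos θ₀) :
    ∃ c, 0 ≤ c ∧ ∀ t ∈ Icc D.T₁ D.T₂, u t = c * D.sol x θ₀ t ∧ v t = c * D.mom x θ₀ t := by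
  obtain ⟨K, hK⟩ := D.exists_lipschitz_system x
  have hR := D.radius_pos x θ₀ D.T₁
  have hc : 0 ≤ |u D.T₁| / D.radius x θ₀ D.T₁ := by positivity
  refine ⟨_, hc, ?_⟩
  set c := |u D.T₁| / D.radius x θ₀ D.T₁ with hcdef
  have key := ODE_solution_unique_of_mem_Icc_right (v := D.system x) (s := fun _ => univ) (K := K)
    (f := fun t => (u t, v t)) (g := fun t => (c * D.sol x θ₀ t, c * D.mom x θ₀ t))
    (a := D.T₁) (b := D.T₂)
    (fun t ht => (hK t (Ico_subset_Icc_self ht)).lipschitzOnWith) (hu.prodMk hv)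
    (fun t ht => (hu' t ht).prodMk (hv' t ht)) (fun _ _ => mem_univ _)
    (((D.continuousOn_sol x θ₀).const_mul c).prodMk ((D.continuousOn_mom x θ₀).const_mul c))
    (fun t ht => by
      have h1 := ((D.hasDerivAt_sol x θ₀ (Ico_subset_Icc_self ht)).const_mul c).prodMk
        ((D.hasDerivAt_mom x θ₀ (Ico_subset_Icc_self ht)).const_mul c)
      refine (h1.congr_deriv ?_).hasDerivWithinAt
      simp only [system, part_mul_of_nonneg hc]
      ext <;> simp only <;> ring)
    (fun _ _ => mem_univ _)
    (by
      simp only [sol, mom, D.angle_left, hv0, hθ, Prod.mk.injEq]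
      refine ⟨?_, by simp⟩
      rw [hcdef, ← mul_assoc, div_mul_cancel₀ _ hR.ne', ← hu0])
  exact fun t ht => Prod.mk.inj (key ht)

/-- At a level where the cosine vanishes the field equals `α > 0` for all parameters, so such a
level is only crossed upwards. -/
lemma angle_lt_of_cos_eq_zero {c s t : ℝ} (hc : Real.cos c = 0) (hs : s ∈ Icc D.T₁ D.T₂)
    (ht : t ∈ Icc D.T₁ D.T₂) (hst : s < t) (h : c ≤ D.angle x θ₀ s) : c < D.angle x θ₀ t :=
  lt_of_deriv_pos (fun r hr => D.hasDerivAt_angle x θ₀ ⟨hs.1.trans hr.1, hr.2.trans ht.2⟩)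
    (fun r _ hrc => by rw [hrc, field_of_cos_eq_zero _ _ _ hc]; exact D.α_pos r) h hst

/-- The zeros are the passages through the levels `θ₀ + π / 2 + i π` strictly between the two end
values; each is attained, and only once. -/
lemma encard_zeros (hθ : Real.sin θ₀ = 0) {j : ℤ} (hj : D.angle x θ₀ D.T₂ = θ₀ + j * Real.pi) :
    ∃ k : ℕ, j = k ∧ {t ∈ Ioo D.T₁ D.T₂ | Real.cos (D.angle x θ₀ t) = 0}.encard = k := by
  have hpi := Real.pi_pos
  have hlev : ∀ i : ℤ, Real.cos (θ₀ + Real.pi / 2 + i * Real.pi) = 0 := fun i => by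
    rw [Real.cos_add_int_mul_pi, Real.cos_add_pi_div_two, hθ]; simp
  have hj0 : 0 ≤ j := by
    -- The level `θ₀ - π / 2` lies below the initial value and can never be reached, which excludes
    -- `j < 0`.
    have h := D.angle_lt_of_cos_eq_zero x θ₀ (hlev (-1)) D.left_mem D.right_mem D.lt
      (by rw [angle_left]; push_cast; linarith)
    rw [hj] at h
    push_cast at h
    have : (-1 : ℝ) < j := by
      by_contra hcon
      have := mul_le_mul_of_nonneg_right (not_lt.1 hcon) hpi.le
      linarith
    have : (-1 : ℤ) < j := by exact_mod_cast this
    omega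
  obtain ⟨k, rfl⟩ := Int.eq_ofNat_of_zero_le hj0
  refine ⟨k, rfl, ?_⟩
  push_cast at hj
  have hinj : InjOn (D.angle x θ₀) {t ∈ Ioo D.T₁ D.T₂ | Real.cos (D.angle x θ₀ t) = 0} := by
    have haux : ∀ s t, s ∈ Ioo D.T₁ D.T₂ → t ∈ Ioo D.T₁ D.T₂ → Real.cos (D.angle x θ₀ s) = 0 →
        D.angle x θ₀ s = D.angle x θ₀ t → ¬ s < t := fun s t hs ht hs0 hst hlt => by
      have := D.angle_lt_of_cos_eq_zero x θ₀ hs0 (Ioo_subset_Icc_self hs)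
        (Ioo_subset_Icc_self ht) hlt le_rfl
      exact this.ne hst
    intro s hs t ht hst
    exact le_antisymm (not_lt.1 (haux t s ht.1 hs.1 ht.2 hst.symm))
      (not_lt.1 (haux s t hs.1 ht.1 hs.2 hst))
  have himg : D.angle x θ₀ '' {t ∈ Ioo D.T₁ D.T₂ | Real.cos (D.angle x θ₀ t) = 0}
      = (fun i : ℕ => θ₀ + Real.pi / 2 + i * Real.pi) '' Iio k := by
    ext y
    constructor
    · rintro ⟨t, ⟨ht, ht0⟩, rfl⟩
      have hts := Ioo_subset_Icc_self ht
      have hs : Real.sin (D.angle x θ₀ t - (θ₀ + Real.pi / 2)) = 0 := by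
        rw [← sub_sub, Real.sin_sub_pi_div_two, Real.cos_sub, ht0, hθ]; simp
      obtain ⟨i, hi⟩ := Real.sin_eq_zero_iff.1 hs
      have hi' : D.angle x θ₀ t = θ₀ + Real.pi / 2 + i * Real.pi := by linarith
      have hlt := D.angle_lt_of_cos_eq_zero x θ₀ ht0 hts D.right_mem ht.2 le_rfl
      have hgt := D.angle_lt_of_cos_eq_zero x θ₀ (hlev (-1)) D.left_mem hts ht.1
        (by rw [angle_left]; push_cast; linarith)
      rw [hi'] at hlt hgt
      rw [hj] at hlt
      push_cast at hgt
      have h1 : (i : ℝ) < k := by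
        by_contra hcon
        have := mul_le_mul_of_nonneg_right (not_lt.1 hcon) hpi.le
        linarith
      have h2 : (-1 : ℝ) < i := by
        by_contra hcon
        have := mul_le_mul_of_nonneg_right (not_lt.1 hcon) hpi.le
        linarith
      have h1' : i < k := by exact_mod_cast h1
      have h2' : -1 < i := by exact_mod_cast h2
      obtain ⟨l, rfl⟩ := Int.eq_ofNat_of_zero_le (show 0 ≤ i by omega)
      exact ⟨l, by simpa using h1', by rw [hi']; simp⟩
    · rintro ⟨i, hi, rfl⟩
      have hik : (i : ℝ) + 1 ≤ k := by exact_mod_cast hi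
      have h1 := mul_le_mul_of_nonneg_right hik hpi.le
      have hi0 : (0 : ℝ) ≤ i * Real.pi := by positivity
      obtain ⟨t, ht, hty⟩ := intermediate_value_Ioo D.lt.le (D.continuousOn_angle x θ₀)
        (show θ₀ + Real.pi / 2 + i * Real.pi ∈ Ioo _ _ by
          rw [angle_left, hj]
          constructor <;> nlinarith)
      exact ⟨t, ⟨ht, by rw [hty]; exact hlev i⟩, hty⟩
  have hinj2 : Function.Injective fun i : ℕ => θ₀ + Real.pi / 2 + i * Real.pi := fun i l h => by
    have := mul_right_cancel₀ hpi.ne' (add_left_cancel h)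
    exact_mod_cast this
  rw [← hinj.encard_image, himg, hinj2.encard_image]
  have : Iio k = (Finset.range k : Set ℕ) := by ext; simp
  rw [this, Set.encard_coe_eq_coe_finsetCard, Finset.card_range]

end Coeffs

/-! ### The sets `C` in terms of the final angle. -/

/-- The initial Prüfer angle of a solution of sign `σ` at the left end. -/
def startAngle (σ : ℤˣ) : ℝ := if σ = 1 then 0 else Real.pi

lemma sin_startAngle (σ : ℤˣ) : Real.sin (startAngle σ) = 0 := by
  unfold startAngle; split_ifs <;> simp

lemma cos_startAngle (σ : ℤˣ) : Real.cos (startAngle σ) = sgn σ := by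
  rcases Int.units_eq_one_or σ with rfl | rfl <;> simp [startAngle, sgn]

lemma cos_startAngle_add (σ : ℤˣ) (k : ℕ) :
    Real.cos (startAngle σ + k * Real.pi) = sgn (σ * (-1) ^ k) := by
  rw [Real.cos_add_nat_mul_pi, cos_startAngle, sgn_mul]
  simp [sgn, mul_comm]

lemma sin_startAngle_add (σ : ℤˣ) (k : ℕ) :
    Real.sin (startAngle σ + k * Real.pi) = 0 := by
  rw [Real.sin_add_nat_mul_pi, sin_startAngle, mul_zero]

/-- A solution with `u' (T₁) = 0` is a nonnegative multiple of a Prüfer solution, and `u T₂ ≠ 0`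
makes the factor positive. The condition at `T₂` says that the gain is a multiple of `π`, and this
multiple counts the zeros. Each zero flips the sign, so the initial sign is `σ * (-1) ^ k`. -/
lemma mem_C_iff (D : Coeffs) (x : ℤˣ → ℝ) {p q m n : ℝ → ℝ} {a b : ℝ}
    (hp : ∀ t ∈ Icc D.T₁ D.T₂, D.α t * p t = 1) (hq : ∀ t ∈ Icc D.T₁ D.T₂, D.q t = q t)
    (hm : ∀ t ∈ Icc D.T₁ D.T₂, x 1 * D.w 1 t = a * m t)
    (hn : ∀ t ∈ Icc D.T₁ D.T₂, x (-1) * D.w (-1) t = b * n t) (k : ℕ) (σ : ℤˣ) :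
    (a, b) ∈ C D.T₁ D.T₂ p q m n k σ ↔
      D.angle x (startAngle (σ * (-1) ^ k)) D.T₂
        = startAngle (σ * (-1) ^ k) + k * Real.pi := by
  have hud := uniqueDiffOn_Icc D.lt
  constructor
  · rintro ⟨u, hu, hcard, hpos⟩
    have hpc : ContinuousOn p (Icc D.T₁ D.T₂) := by
      have : ContinuousOn (fun t => (D.α t)⁻¹) (Icc D.T₁ D.T₂) :=
        (D.continuous_α.inv₀ fun t => (D.α_pos t).ne').continuousOn
      exact this.congr fun t ht => eq_inv_of_mul_eq_one_right (hp t ht)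
    have hdc := hu.contDiffOn.continuousOn_derivWithin hud le_rfl
    have hvc := hpc.mul hdc
    set v : ℝ → ℝ := fun s => p s * derivWithin u (Icc D.T₁ D.T₂) s with hv
    have hvc : ContinuousOn v (Icc D.T₁ D.T₂) := hvc
    have huc := hu.contDiffOn.continuousOn
    set g : ℝ → ℝ := fun t => D.q t * u t - (x 1 * D.w 1 t * part 1 (u t)
        - x (-1) * D.w (-1) t * part (-1) (u t)) with hg
    have hgc : ContinuousOn g (Icc D.T₁ D.T₂) := by
      have h1 := fun τ => (continuous_part τ).comp_continuousOn huc
      have h2 := fun τ => (D.continuous_w τ).continuousOn (s := Icc D.T₁ D.T₂)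
      exact (D.continuous_q.continuousOn.mul huc).sub
        (((h2 1).const_mul (x 1)).mul (h1 1) |>.sub (((h2 (-1)).const_mul (x (-1))).mul (h1 (-1))))
    have hvd : ∀ t ∈ Ioo D.T₁ D.T₂, HasDerivAt v (g t) t := fun t ht => by
      have ht' := Ioo_subset_Icc_self ht
      refine (hu.equation t ht).congr_deriv ?_
      rw [hg]
      simp only [hq t ht', hm t ht', hn t ht']
    have hvd' : ∀ t ∈ Ico D.T₁ D.T₂, HasDerivWithinAt v (g t) (Ici t) t := by
      intro t ht
      rcases eq_or_lt_of_le ht.1 with rfl | h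
      -- The equation is given in the open interval only; the right derivative of `p u'` at `T₁` is
      -- recovered as a limit of derivatives.
      · refine hasDerivWithinAt_Ici_of_tendsto_deriv (s := Ioo D.T₁ D.T₂)
          (fun s hs => (hvd s hs).differentiableAt.differentiableWithinAt)
          ((hvc _ D.left_mem).mono Ioo_subset_Icc_self) (Ioo_mem_nhdsGT D.lt) ?_
        have h1 : Tendsto g (𝓝[>] D.T₁) (𝓝 (g D.T₁)) :=
          (hgc _ D.left_mem).tendsto.mono_left
            (nhdsWithin_le_of_mem (Icc_mem_nhdsGT D.lt))
        refine h1.congr' ?_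
        filter_upwards [Ioo_mem_nhdsGT D.lt] with s hs using (hvd s hs).deriv.symm
      · exact (hvd t ⟨h, ht.2⟩).hasDerivWithinAt
    have hud' : ∀ t ∈ Ico D.T₁ D.T₂, HasDerivWithinAt u (D.α t * v t) (Ici t) t := by
      intro t ht
      have ht' := Ico_subset_Icc_self ht
      have h1 := ((hu.contDiffOn.differentiableOn one_ne_zero) t ht').hasDerivWithinAt
      have h2 : derivWithin u (Icc D.T₁ D.T₂) t = D.α t * v t := by
        rw [hv]; simp only; rw [← mul_assoc, hp t ht', one_mul]
      rw [h2] at h1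
      exact h1.mono_of_mem_nhdsWithin (mem_of_superset (Icc_mem_nhdsGE ht.2)
        (Icc_subset_Icc_left ht.1))
    obtain ⟨τ, hτ⟩ : ∃ τ : ℤˣ, u D.T₁ = |u D.T₁| * Real.cos (startAngle τ) := by
      rcases le_total 0 (u D.T₁) with h | h
      · exact ⟨1, by simp [cos_startAngle, sgn, abs_of_nonneg h]⟩
      · exact ⟨-1, by simp [cos_startAngle, sgn, abs_of_nonpos h]⟩
    obtain ⟨c, hc0, hc⟩ := D.eq_mul_sol x (startAngle τ) huc hvc hud' hvd'
      (by simp [hv, hu.neumann_left]) (sin_startAngle τ) hτ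
    have hcpos : 0 < c := by
      refine lt_of_le_of_ne hc0 fun h => ?_
      rw [(hc _ D.right_mem).1, ← h] at hpos
      simp at hpos
    have hv2 : v D.T₂ = 0 := by simp [hv, hu.neumann_right]
    rw [(hc _ D.right_mem).2, Coeffs.mom, D.radius_right] at hv2
    have hsin : Real.sin (D.angle x (startAngle τ) D.T₂ - startAngle τ) = 0 := by
      have : Real.sin (D.angle x (startAngle τ) D.T₂) = 0 := by
        simpa [hcpos.ne'] using hv2
      rw [Real.sin_sub, this, sin_startAngle]; simp
    obtain ⟨j, hj⟩ := Real.sin_eq_zero_iff.1 hsin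
    obtain ⟨k', rfl, hk'⟩ := D.encard_zeros x (startAngle τ) (sin_startAngle τ) (j := j)
      (by linarith)
    have hset : {t ∈ Ioo D.T₁ D.T₂ | u t = 0}
        = {t ∈ Ioo D.T₁ D.T₂ | Real.cos (D.angle x (startAngle τ) t) = 0} := by
      ext t
      refine and_congr_right fun ht => ?_
      rw [(hc t (Ioo_subset_Icc_self ht)).1, Coeffs.sol]
      simp [hcpos.ne', (D.radius_pos x (startAngle τ) t).ne']
    rw [hset, hk'] at hcard
    obtain rfl : k' = k := by exact_mod_cast hcard
    have hφ : D.angle x (startAngle τ) D.T₂ = startAngle τ + k' * Real.pi := by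
      push_cast at hj; linarith
    have hτσ : τ = σ * (-1) ^ k' := by
      rw [(hc _ D.right_mem).1, Coeffs.sol, D.radius_right, hφ, cos_startAngle_add, one_mul,
        mul_left_comm, ← sgn_mul] at hpos
      have h1 : 0 < sgn (σ * (τ * (-1) ^ k')) := pos_of_mul_pos_right hpos hc0
      have h2 : σ * (τ * (-1) ^ k') = 1 := by
        rcases Int.units_eq_one_or (σ * (τ * (-1) ^ k')) with h | h
        · exact h
        · rw [h, sgn_neg_one] at h1; norm_num at h1
      have h3 : ((-1) ^ k' : ℤˣ) * (-1) ^ k' = 1 := Int.units_mul_self _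
      have h4 : σ * σ = 1 := Int.units_mul_self _
      calc τ = (σ * σ) * τ * ((-1) ^ k' * (-1) ^ k') := by rw [h3, h4]; simp
        _ = σ * (σ * (τ * (-1) ^ k')) * (-1) ^ k' := by simp only [mul_assoc]
        _ = _ := by rw [h2, mul_one]
    rw [← hτσ]
    exact hφ
  · intro h
    set τ := σ * (-1) ^ k with hτ
    have hder : ∀ t ∈ Icc D.T₁ D.T₂, derivWithin (D.sol x (startAngle τ)) (Icc D.T₁ D.T₂) t
        = D.α t * D.mom x (startAngle τ) t := fun t ht =>
      (D.hasDerivAt_sol x _ ht).hasDerivWithinAt.derivWithin (hud t ht)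
    have hστ : τ * (-1) ^ k = σ := by
      rw [hτ, mul_assoc, Int.units_mul_self, mul_one]
    refine ⟨D.sol x (startAngle τ), ⟨?_, ?_, ?_, ?_⟩, ?_, ?_⟩
    · rw [contDiffOn_one_iff_derivWithin hud]
      refine ⟨fun t ht => (D.hasDerivAt_sol x _ ht).differentiableAt.differentiableWithinAt, ?_⟩
      exact (D.continuous_α.continuousOn.mul (D.continuousOn_mom x _)).congr hder
    · intro t ht
      have ht' := Ioo_subset_Icc_self ht
      have h1 := D.hasDerivAt_mom x (startAngle τ) ht'
      rw [hq t ht', hm t ht', hn t ht'] at h1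
      refine h1.congr_of_eventuallyEq ?_
      filter_upwards [Icc_mem_nhds ht.1 ht.2] with s hs
      rw [hder s hs, ← mul_assoc, mul_comm (p s), hp s hs, one_mul]
    · rw [hder _ D.left_mem, Coeffs.mom, D.angle_left, sin_startAngle]; simp
    · rw [hder _ D.right_mem, Coeffs.mom, h, sin_startAngle_add]; simp
    · obtain ⟨k', hk, hk'⟩ := D.encard_zeros x (startAngle τ) (sin_startAngle τ) (j := k)
        (by push_cast; exact h)
      obtain rfl : k = k' := by exact_mod_cast hk
      rw [← hk']
      congr 1
      ext t
      refine and_congr_right fun ht => ?_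
      simp [Coeffs.sol, (D.radius_pos x (startAngle τ) t).ne']
    · rw [Coeffs.sol, D.radius_right, h, cos_startAngle_add, hστ, one_mul, sgn_mul_self]
      exact one_pos

/-! ### Alternating chains of points. -/

/-- There are points `t₀ < ⋯ < tₖ = t` in `]T₁, T₂[` at which the functions `W τ` are positive,
where `τ` alternates between `1` and `-1` and ends with `σ`. -/
def Alternates (T₁ T₂ : ℝ) (W : ℤˣ → ℝ → ℝ) : ℕ → ℤˣ → ℝ → Prop
  | 0, σ, t => t ∈ Ioo T₁ T₂ ∧ 0 < W σ t
  | k + 1, σ, t => (t ∈ Ioo T₁ T₂ ∧ 0 < W σ t) ∧ ∃ s < t, Alternates T₁ T₂ W k (-σ) s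

namespace Alternates

variable {T₁ T₂ : ℝ} {W W' : ℤˣ → ℝ → ℝ} {k : ℕ} {σ : ℤˣ} {t : ℝ}

lemma mem_and_pos (h : Alternates T₁ T₂ W k σ t) : t ∈ Ioo T₁ T₂ ∧ 0 < W σ t := by
  cases k with
  | zero => exact h
  | succ k => exact h.1

lemma mono (hW : ∀ τ t, t ∈ Ioo T₁ T₂ → 0 < W τ t → 0 < W' τ t) :
    ∀ {k : ℕ} {σ : ℤˣ} {t : ℝ}, Alternates T₁ T₂ W k σ t → Alternates T₁ T₂ W' k σ t
  | 0, _, _, h => ⟨h.1, hW _ _ h.1 h.2⟩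
  | _ + 1, _, _, ⟨h, s, hs, h'⟩ => ⟨⟨h.1, hW _ _ h.1 h.2⟩, s, hs, h'.mono hW⟩

/-- The first point is dropped, which keeps the final sign; dropping the last point, which reverses
it, is immediate from the definition. -/
lemma of_succ : ∀ {k : ℕ} {σ : ℤˣ} {t : ℝ}, Alternates T₁ T₂ W (k + 1) σ t →
    Alternates T₁ T₂ W k σ t
  | 0, _, _, h => h.1
  | _ + 1, _, _, ⟨h, s, hs, h'⟩ => ⟨h, s, hs, h'.of_succ⟩

lemma exists_gt (hW : ∀ τ, Continuous (W τ)) (h : Alternates T₁ T₂ W k σ t) :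
    ∃ t' > t, Alternates T₁ T₂ W k σ t' := by
  have hev : ∀ᶠ r in 𝓝[>] t, r ∈ Ioo T₁ T₂ ∧ 0 < W σ r :=
    nhdsWithin_le_nhds ((isOpen_Ioo.eventually_mem h.mem_and_pos.1).and
      ((hW σ).continuousAt.eventually_const_lt h.mem_and_pos.2))
  obtain ⟨r, hr, hrt⟩ := (hev.and self_mem_nhdsWithin).exists
  refine ⟨r, hrt, ?_⟩
  cases k with
  | zero => exact hr
  | succ k =>
    obtain ⟨_, s, hs, h'⟩ := h
    exact ⟨hr, s, hs.trans hrt, h'⟩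

/-- The chain that ends first is prolonged by the last point of the other. The two last points may
coincide, since both weights may be positive there; then `exists_gt` moves one of them to the right.
-/
lemma exists_succ (hW : ∀ τ, Continuous (W τ)) {s : ℝ} (h : Alternates T₁ T₂ W k σ t)
    (h' : Alternates T₁ T₂ W k (-σ) s) :
    (∃ r, Alternates T₁ T₂ W (k + 1) σ r) ∨ ∃ r, Alternates T₁ T₂ W (k + 1) (-σ) r := by
  have key : ∀ {σ t s}, s < t → Alternates T₁ T₂ W k σ t → Alternates T₁ T₂ W k (-σ) s →
      Alternates T₁ T₂ W (k + 1) σ t := fun hst h h' => ⟨h.mem_and_pos, _, hst, h'⟩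
  rcases lt_trichotomy s t with hst | rfl | hst
  · exact Or.inl ⟨t, key hst h h'⟩
  · obtain ⟨t', ht', h1⟩ := h.exists_gt hW
    exact Or.inl ⟨t', key ht' h1 h'⟩
  · exact Or.inr ⟨s, key hst h' (by rwa [neg_neg])⟩

end Alternates

/-! ### Chains forced by a gain of the angle, and gains forced by a chain. -/

namespace Coeffs

variable (D : Coeffs) (x : ℤˣ → ℝ) (θ₀ : ℝ)

lemma field_eq (τ : ℤˣ) (t θ : ℝ) : D.field x t θ
    = D.α t + D.coef x τ t * cosSq τ θ + D.coef x (-τ) t * cosSq (-τ) θ := by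
  rcases Int.units_eq_one_or τ with rfl | rfl
  · rfl
  · rw [neg_neg]; unfold field; ring

lemma field_add {τ : ℤˣ} {c : ℝ} (hs : Real.sin c = 0) (hc : Real.cos c = sgn τ) (t : ℝ) {y : ℝ}
    (hy : 0 ≤ Real.cos y) : D.field x t (c + y)
      = D.α t * Real.sin y ^ 2 + (x τ * D.w τ t - D.q t) * Real.cos y ^ 2 := by
  have h1 : Real.cos (c + y) = sgn τ * Real.cos y := by rw [Real.cos_add, hs, hc]; ring
  have h2 : sgn τ * (sgn τ * Real.cos y) = Real.cos y := by rw [← mul_assoc, sgn_mul_self, one_mul]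
  have h3 : cosSq τ (c + y) = Real.cos y ^ 2 := by
    rw [cosSq, h1, part_of_nonneg (by rw [h2]; exact hy), h2]
  have h4 : cosSq (-τ) (c + y) = 0 := by
    rw [cosSq, h1, part_of_nonpos (by rw [sgn_neg, neg_mul, h2]; linarith)]; norm_num
  rw [D.field_eq x τ, h3, h4, Real.sin_sq]
  unfold coef
  ring

/-- Writing `sin² y = (sin y * sinc y) * y` makes the inequality linear in `y = θ - c` with a
continuous coefficient, so that a negative or zero deviation from `c` cannot become positive. -/
lemma exists_angle_sub_le {c s t : ℝ} (hs : s ∈ Icc D.T₁ D.T₂) (ht : t ∈ Icc D.T₁ D.T₂)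
    (hst : s ≤ t) (h : ∀ r ∈ Ioo s t, D.field x r (D.angle x θ₀ r)
      ≤ D.α r * Real.sin (D.angle x θ₀ r - c) ^ 2) :
    ∃ E > 0, D.angle x θ₀ t - c ≤ (D.angle x θ₀ s - c) * E := by
  have hext := D.continuous_angleExt x θ₀
  have hA : Continuous fun r => D.α r * (Real.sin (D.angleExt x θ₀ r - c)
      * Real.sinc (D.angleExt x θ₀ r - c)) := by
    have := Real.continuous_sinc.comp (hext.sub (continuous_const (y := c)))
    have h2 := D.continuous_α
    exact h2.mul ((Real.continuous_sin.comp (hext.sub continuous_const)).mul this)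
  have hmem : ∀ r ∈ Icc s t, r ∈ Icc D.T₁ D.T₂ := fun r hr => ⟨hs.1.trans hr.1, hr.2.trans ht.2⟩
  refine ⟨_, Real.exp_pos _, le_mul_exp_of_deriv_le hst hA
    (fun r hr => (D.hasDerivAt_angle x θ₀ (hmem r hr)).sub_const c) fun r hr => ?_⟩
  refine (h r hr).trans_eq ?_
  rw [D.angleExt_of_mem x θ₀ (hmem r (Ioo_subset_Icc_self hr))]
  have : Real.sin (D.angle x θ₀ r - c)
      = Real.sinc (D.angle x θ₀ r - c) * (D.angle x θ₀ r - c) := by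
    rcases eq_or_ne (D.angle x θ₀ r - c) 0 with h0 | h0
    · rw [h0]; simp
    · rw [Real.sinc_of_ne_zero h0]; field_simp
  rw [mul_assoc, mul_assoc, ← this, sq]

lemma angle_zero_le (hθ : Real.sin θ₀ = 0) : D.angle 0 θ₀ D.T₂ ≤ θ₀ := by
  obtain ⟨E, hE, h⟩ := D.exists_angle_sub_le 0 θ₀ (c := θ₀) D.left_mem D.right_mem D.lt.le
    (fun r _ => by
      have h1 := cosSq_add_cosSq (D.angle 0 θ₀ r)
      have h2 : Real.sin (D.angle 0 θ₀ r - θ₀) ^ 2 = Real.sin (D.angle 0 θ₀ r) ^ 2 := by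
        rw [Real.sin_sub, hθ, mul_zero, sub_zero, mul_pow, Real.cos_sq', hθ]; ring
      rw [h2, Real.sin_sq, ← h1]
      unfold field coef
      have := mul_nonneg (D.q_nonneg r) (add_nonneg (cosSq_nonneg 1 (D.angle 0 θ₀ r))
        (cosSq_nonneg (-1) (D.angle 0 θ₀ r)))
      simp only [Pi.zero_apply]
      linarith)
  rw [D.angle_left, sub_self, zero_mul] at h
  linarith

/-- Within `π / 2` of `c` the solution has the sign `τ`, so only `w τ` matters. Were `x τ * w τ ≤ 0`
throughout, then `θ' ≤ α sin² (θ - c)`, and the angle could neither reach `c` from strictly below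
nor leave it upwards. -/
lemma exists_pos_weight {τ : ℤˣ} {c s t : ℝ} (hsin : Real.sin c = 0) (hcos : Real.cos c = sgn τ)
    (hs : s ∈ Icc D.T₁ D.T₂) (ht : t ∈ Icc D.T₁ D.T₂) (hst : s < t)
    (hlo : c - Real.pi / 2 ≤ D.angle x θ₀ s) (hhi : D.angle x θ₀ t < c + Real.pi / 2)
    (hsc : D.angle x θ₀ s ≤ c) (htc : c ≤ D.angle x θ₀ t)
    (hne : D.angle x θ₀ s < c ∨ c < D.angle x θ₀ t) : ∃ r ∈ Ioo s t, 0 < x τ * D.w τ r := by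
  by_contra! hcon
  have hcp : Real.cos (c + Real.pi / 2) = 0 := by rw [Real.cos_add_pi_div_two, hsin, neg_zero]
  have hcm : Real.cos (c - Real.pi / 2) = 0 := by rw [Real.cos_sub_pi_div_two, hsin]
  obtain ⟨E, hE, h⟩ := D.exists_angle_sub_le x θ₀ (c := c) hs ht hst.le (fun r hr => by
    have hr' : r ∈ Icc D.T₁ D.T₂ := ⟨hs.1.trans hr.1.le, hr.2.le.trans ht.2⟩
    have h1 : c - Real.pi / 2 < D.angle x θ₀ r :=
      D.angle_lt_of_cos_eq_zero x θ₀ hcm hs hr' hr.1 hlo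
    have h2 : D.angle x θ₀ r < c + Real.pi / 2 := by
      by_contra! hcon'
      exact (D.angle_lt_of_cos_eq_zero x θ₀ hcp hr' ht hr.2 hcon').not_gt hhi
    have h3 := D.field_add x hsin hcos r (y := D.angle x θ₀ r - c)
      (Real.cos_nonneg_of_mem_Icc ⟨by linarith, by linarith⟩)
    rw [add_sub_cancel] at h3
    rw [h3]
    have h4 := hcon r hr
    have h5 := D.q_nonneg r
    nlinarith [sq_nonneg (Real.cos (D.angle x θ₀ r - c))])
  rcases hne with h' | h'
  · have := mul_neg_of_neg_of_pos (sub_neg.2 h') hE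
    linarith
  · have := mul_nonpos_of_nonpos_of_nonneg (sub_nonpos.2 hsc) hE.le
    linarith

/-- Every level reached or passed costs a point of positive weight. For `i ≠ 0` attaining the level
is enough, because the angle comes from strictly below; for `i = 0` it starts on the level and must
exceed it. -/
lemma exists_alternates (σ : ℤˣ) (i : ℕ) : ∀ t ∈ Icc D.T₁ D.T₂,
    (startAngle σ + i * Real.pi < D.angle x (startAngle σ) t ∨
      i ≠ 0 ∧ startAngle σ + i * Real.pi = D.angle x (startAngle σ) t) →
    ∃ y < t, Alternates D.T₁ D.T₂ (fun τ r => x τ * D.w τ r) i (σ * (-1) ^ i) y := by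
  have hpi := Real.pi_pos
  induction i with
  | zero =>
    intro t ht h
    have h0 : startAngle σ < D.angle x (startAngle σ) t := by simpa using h
    obtain ⟨t', ht', hlo, hhi⟩ : ∃ t' ∈ Icc D.T₁ t, startAngle σ < D.angle x (startAngle σ) t' ∧
        D.angle x (startAngle σ) t' < startAngle σ + Real.pi / 2 := by
      by_cases hcase : D.angle x (startAngle σ) t < startAngle σ + Real.pi / 2
      · exact ⟨t, right_mem_Icc.2 ht.1, h0, hcase⟩
      · obtain ⟨t', ht', he⟩ := intermediate_value_Icc ht.1
          ((D.continuousOn_angle x (startAngle σ)).mono (Icc_subset_Icc_right ht.2))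
          (show startAngle σ + Real.pi / 4 ∈ Icc _ _ by
            rw [angle_left]; constructor <;> linarith)
        exact ⟨t', ht', by linarith, by linarith⟩
    have ht'' : t' ∈ Icc D.T₁ D.T₂ := ⟨ht'.1, ht'.2.trans ht.2⟩
    have hlt : D.T₁ < t' := lt_of_le_of_ne ht'.1 fun he => by
      rw [← he, angle_left] at hlo; exact hlo.false
    obtain ⟨r, hr, hpos⟩ := D.exists_pos_weight x (startAngle σ) (sin_startAngle σ)
      (cos_startAngle σ) D.left_mem ht'' hlt (by rw [angle_left]; linarith) hhi
      (D.angle_left _ _).le hlo.le (Or.inr hlo)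
    exact ⟨r, hr.2.trans_le ht'.2, ⟨hr.1, hr.2.trans_le ht''.2⟩, by simpa using hpos⟩
  | succ i ih =>
    intro t ht h
    set c := startAngle σ + (i + 1 : ℕ) * Real.pi with hc
    have hc' : c = startAngle σ + i * Real.pi + Real.pi := by rw [hc]; push_cast; ring
    have hi0 : 0 ≤ i * Real.pi := by positivity
    have h0 : c ≤ D.angle x (startAngle σ) t := by
      rcases h with h | h
      exacts [h.le, h.2.le]
    obtain ⟨t', ht', hlo, hhi⟩ : ∃ t' ∈ Icc D.T₁ t, c ≤ D.angle x (startAngle σ) t' ∧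
        D.angle x (startAngle σ) t' < c + Real.pi / 2 := by
      obtain ⟨t', ht', he⟩ := intermediate_value_Icc ht.1
        ((D.continuousOn_angle x (startAngle σ)).mono (Icc_subset_Icc_right ht.2))
        (show c ∈ Icc _ _ by rw [angle_left]; constructor <;> linarith)
      exact ⟨t', ht', by linarith, by linarith⟩
    have ht'' : t' ∈ Icc D.T₁ D.T₂ := ⟨ht'.1, ht'.2.trans ht.2⟩
    -- At `s` the solution vanishes: the angle is `π / 2` below `c` and already `π / 2` above the
    -- preceding level, so the earlier chain ends before `s` and the new point comes after it.
    obtain ⟨s, hs, hse⟩ := intermediate_value_Icc ht'.1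
      ((D.continuousOn_angle x (startAngle σ)).mono (Icc_subset_Icc_right ht''.2))
      (show c - Real.pi / 2 ∈ Icc _ _ by rw [angle_left]; constructor <;> linarith)
    have hs' : s ∈ Icc D.T₁ D.T₂ := ⟨hs.1, hs.2.trans ht''.2⟩
    have hst : s < t' := lt_of_le_of_ne hs.2 fun he => by rw [← he] at hlo; linarith
    obtain ⟨r, hr, hpos⟩ := D.exists_pos_weight x (startAngle σ) (sin_startAngle_add σ (i + 1))
      (cos_startAngle_add σ (i + 1)) hs' ht'' hst hse.ge hhi (by linarith) hlo
      (Or.inl (by linarith))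
    obtain ⟨y, hy, hya⟩ := ih s hs' (Or.inl (by linarith))
    have hsign : -(σ * (-1) ^ (i + 1)) = σ * (-1) ^ i := by rw [pow_succ]; simp
    exact ⟨r, hr.2.trans_le ht'.2, ⟨⟨hs'.1.trans_lt hr.1, hr.2.trans_le ht''.2⟩, hpos⟩, y,
      hy.trans hr.1, by rwa [hsign]⟩

/-- Where the weight is positive, the angle is increased by `π` if the parameter is large. -/
lemma exists_lt_angle {τ : ℤˣ} {c z s t : ℝ} (hsin : Real.sin c = 0) (hcos : Real.cos c = sgn τ)
    (hs : D.T₁ ≤ s) (ht : t ≤ D.T₂) (hz : z ∈ Ioo s t) (hw : 0 < D.w τ z) :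
    ∃ Λ : ℝ, ∀ l ≥ Λ, c - Real.pi / 2 ≤ D.angle (fun _ => l) θ₀ s →
      c + Real.pi / 2 < D.angle (fun _ => l) θ₀ t := by
  have hpi := Real.pi_pos
  have hcp : Real.cos (c + Real.pi / 2) = 0 := by rw [Real.cos_add_pi_div_two, hsin, neg_zero]
  have hcm : Real.cos (c - Real.pi / 2) = 0 := by rw [Real.cos_sub_pi_div_two, hsin]
  obtain ⟨ε, hε, hball⟩ := Metric.mem_nhds_iff.1 ((isOpen_Ioo.eventually_mem hz).and
    ((D.continuous_w τ).continuousAt.eventually_const_lt (half_lt_self hw)) :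
      ∀ᶠ r in 𝓝 z, r ∈ Ioo s t ∧ D.w τ z / 2 < D.w τ r)
  have hball' : ∀ r ∈ Icc (z - ε / 2) (z + ε / 2), r ∈ Ioo s t ∧ D.w τ z / 2 < D.w τ r :=
    fun r hr => hball (by
      rw [Metric.mem_ball, Real.dist_eq, abs_lt]
      constructor <;> linarith [hr.1, hr.2])
  set l₁ := z - ε / 2 with hl₁
  set l₂ := z + ε / 2 with hl₂
  have hl : l₁ < l₂ := by linarith
  have hlen : l₂ - l₁ = ε := by rw [hl₁, hl₂]; ring
  have hmem1 := (hball' l₁ (left_mem_Icc.2 hl.le)).1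
  have hmem2 := (hball' l₂ (right_mem_Icc.2 hl.le)).1
  have hsub : ∀ r ∈ Icc l₁ l₂, r ∈ Icc D.T₁ D.T₂ := fun r hr =>
    ⟨hs.trans (hball' r hr).1.1.le, (hball' r hr).1.2.le.trans ht⟩
  obtain ⟨r₀, -, hr₀⟩ := isCompact_Icc.exists_isMinOn ⟨_, D.left_mem⟩ D.continuous_α.continuousOn
  obtain ⟨r₁, -, hr₁⟩ := isCompact_Icc.exists_isMaxOn ⟨_, D.left_mem⟩ D.continuous_q.continuousOn
  have hα : ∀ r ∈ Icc D.T₁ D.T₂, D.α r₀ ≤ D.α r := fun r hr => hr₀ hr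
  have hq : ∀ r ∈ Icc D.T₁ D.T₂, D.q r ≤ D.q r₁ := fun r hr => hr₁ hr
  have hα0 := D.α_pos r₀
  -- The rescaled angle `ω = arctan (γ tan (φ - c))` has the derivative `γ (α S² + κ C²) / (C² + γ²
  -- S²)`, where `κ = l * w τ - q`. It is at least `π / ε` as soon as `γ π / ε ≤ α` and `π / ε ≤ γ
  -- κ`: the first fixes `γ` through the minimum of `α`, the second fixes the threshold for `l`.
  set γ : ℝ := D.α r₀ * ε / Real.pi with hγ
  have hγ0 : 0 < γ := by positivity
  have hγ' : γ * (Real.pi / ε) = D.α r₀ := by rw [hγ]; field_simp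
  refine ⟨(Real.pi / ε / γ + D.q r₁) / (D.w τ z / 2), fun l hlΛ hstart => ?_⟩
  rw [ge_iff_le, div_le_iff₀ (by positivity)] at hlΛ
  have hl0 : 0 ≤ l := by
    have h1 : 0 < Real.pi / ε / γ := by positivity
    have h2 := D.q_nonneg r₁
    by_contra! hneg
    nlinarith
  by_contra! hend
  set φ := D.angle (fun _ => l) θ₀ with hφ
  have hlow : ∀ r ∈ Icc l₁ l₂, c - Real.pi / 2 < φ r := fun r hr =>
    D.angle_lt_of_cos_eq_zero _ θ₀ hcm ⟨hs, (hz.1.trans hz.2).le.trans ht⟩ (hsub r hr)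
      (hball' r hr).1.1 hstart
  have hupp : ∀ r ∈ Icc l₁ l₂, φ r < c + Real.pi / 2 := fun r hr => by
    by_contra! hcon
    exact (D.angle_lt_of_cos_eq_zero _ θ₀ hcp (hsub r hr)
      ⟨hs.trans (hz.1.trans hz.2).le, ht⟩ (hball' r hr).1.2 hcon).not_ge hend
  have hcospos : ∀ r ∈ Icc l₁ l₂, 0 < Real.cos (φ r - c) := fun r hr =>
    Real.cos_pos_of_mem_Ioo ⟨by linarith [hlow r hr], by linarith [hupp r hr]⟩
  set ω : ℝ → ℝ := fun r => Real.arctan (γ * Real.tan (φ r - c)) with hω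
  have hder : ∀ r ∈ Icc l₁ l₂, ∃ d, HasDerivAt ω d r ∧ Real.pi / ε ≤ d := by
    intro r hr
    have hcr := hcospos r hr
    have h1 := ((Real.hasDerivAt_tan hcr.ne').comp r
      ((D.hasDerivAt_angle (fun _ => l) θ₀ (hsub r hr)).sub_const c)).const_mul γ
    refine ⟨_, h1.arctan, ?_⟩
    have h2 := D.field_add (fun _ => l) hsin hcos r (y := φ r - c) hcr.le
    rw [add_sub_cancel] at h2
    rw [← hφ, h2]
    set C := Real.cos (φ r - c)
    set S := Real.sin (φ r - c)
    have htan : Real.tan (φ r - c) = S / C := Real.tan_eq_sin_div_cos _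
    simp only [Function.comp_apply]
    rw [htan]
    have hden : 0 < C ^ 2 + γ ^ 2 * S ^ 2 := by positivity
    have e : 1 / (1 + (γ * (S / C)) ^ 2) * (γ * (1 / C ^ 2 * (D.α r * S ^ 2
        + (l * D.w τ r - D.q r) * C ^ 2)))
        = γ * (D.α r * S ^ 2 + (l * D.w τ r - D.q r) * C ^ 2) / (C ^ 2 + γ ^ 2 * S ^ 2) := by
      field_simp
    rw [e, le_div_iff₀ hden]
    have hκ : Real.pi / ε / γ ≤ l * D.w τ r - D.q r := by
      have h3 := mul_le_mul_of_nonneg_left (hball' r hr).2.le hl0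
      have h4 := hq r (hsub r hr)
      linarith
    have hκ' : Real.pi / ε ≤ γ * (l * D.w τ r - D.q r) := by
      rw [div_le_iff₀ hγ0] at hκ; linarith
    have hα' : γ * (Real.pi / ε) ≤ D.α r := by rw [hγ']; exact hα r (hsub r hr)
    have h5 := mul_le_mul_of_nonneg_right hκ' (sq_nonneg C)
    have h6 := mul_le_mul_of_nonneg_right hα' (mul_nonneg hγ0.le (sq_nonneg S))
    linarith
  have hmono := Convex.mul_sub_le_image_sub_of_le_deriv (convex_Icc l₁ l₂) (f := ω)
    (C := Real.pi / ε)
    (fun r hr => by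
      obtain ⟨d, hd, _⟩ := hder r hr
      exact hd.continuousAt.continuousWithinAt)
    (fun r hr => by
      obtain ⟨d, hd, _⟩ := hder r (interior_subset hr)
      exact hd.differentiableAt.differentiableWithinAt)
    (fun r hr => by
      obtain ⟨d, hd, hle⟩ := hder r (interior_subset hr)
      rwa [hd.deriv])
    l₁ (left_mem_Icc.2 hl.le) l₂ (right_mem_Icc.2 hl.le) hl.le
  -- Over a length `ε` the function `ω` would rise by at least `π`, but the range of the arctangent
  -- is an open interval of length `π`.
  rw [hlen, div_mul_cancel₀ _ hε.ne'] at hmono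
  have h1 := Real.arctan_lt_pi_div_two (γ * Real.tan (φ l₂ - c))
  have h2 := Real.neg_pi_div_two_lt_arctan (γ * Real.tan (φ l₁ - c))
  simp only [hω] at hmono
  linarith

/-- Midpoints between consecutive points of the chain split the interval. On each piece the angle
passes a full band of width `π`, and the top of one band is the bottom of the next. Equal parameters
serve both weights at once. -/
lemma exists_lt_angle_of_alternates (σ : ℤˣ) (k : ℕ) : ∀ z t,
    Alternates D.T₁ D.T₂ D.w k (σ * (-1) ^ k) z → z < t → t ≤ D.T₂ →
    ∃ Λ : ℝ, ∀ l ≥ Λ, startAngle σ + k * Real.pi + Real.pi / 2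
      < D.angle (fun _ => l) (startAngle σ) t := by
  have hpi := Real.pi_pos
  induction k with
  | zero =>
    intro z t h hzt ht
    obtain ⟨Λ, hΛ⟩ := D.exists_lt_angle (startAngle σ) (sin_startAngle σ) (cos_startAngle σ) le_rfl
      ht ⟨h.mem_and_pos.1.1, hzt⟩ (by simpa using h.mem_and_pos.2)
    refine ⟨Λ, fun l hl => ?_⟩
    have := hΛ l hl (by rw [angle_left]; linarith)
    simpa using this
  | succ k ih =>
    intro z t h hzt ht
    obtain ⟨⟨hz, hpos⟩, y, hy, hya⟩ := h
    have hsign : -(σ * (-1) ^ (k + 1)) = σ * (-1) ^ k := by rw [pow_succ]; simp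
    rw [hsign] at hya
    obtain ⟨Λ, hΛ⟩ := ih y ((y + z) / 2) hya (by linarith) (by linarith [hz.2])
    obtain ⟨Λ', hΛ'⟩ := D.exists_lt_angle (startAngle σ) (s := (y + z) / 2)
      (sin_startAngle_add σ (k + 1))
      (cos_startAngle_add σ (k + 1)) (by linarith [hya.mem_and_pos.1.1]) ht
      ⟨by linarith, hzt⟩ hpos
    refine ⟨max Λ Λ', fun l hl => hΛ' l ((le_max_right _ _).trans hl) ?_⟩
    have := hΛ l ((le_max_left _ _).trans hl)
    push_cast
    linarith

lemma continuous_angle_right : Continuous fun x => D.angle x θ₀ D.T₂ := by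
  have := (D.continuous_angleExt_uncurry θ₀).comp (Continuous.prodMk_left D.T₂)
  simpa only [Function.comp_def, D.angleExt_of_mem _ _ D.right_mem] using this

lemma exists_angle_eq (σ : ℤˣ) (k : ℕ) {z : ℝ}
    (h : Alternates D.T₁ D.T₂ D.w k (σ * (-1) ^ k) z) :
    ∃ l : ℝ, 0 ≤ l ∧ D.angle (fun _ => l) (startAngle σ) D.T₂ = startAngle σ + k * Real.pi := by
  have hpi := Real.pi_pos
  obtain ⟨Λ, hΛ⟩ := D.exists_lt_angle_of_alternates σ k z D.T₂ h h.mem_and_pos.1.2 le_rfl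
  have hc : Continuous fun l : ℝ => D.angle (fun _ => l) (startAngle σ) D.T₂ :=
    (D.continuous_angle_right (startAngle σ)).comp (by fun_prop)
  have h0 : D.angle (fun _ => 0) (startAngle σ) D.T₂ ≤ startAngle σ :=
    D.angle_zero_le _ (sin_startAngle σ)
  have hk : 0 ≤ k * Real.pi := by positivity
  obtain ⟨l, hl, he⟩ := intermediate_value_Icc (le_max_right Λ 0) hc.continuousOn
    (show startAngle σ + k * Real.pi ∈ Icc _ _ from
      ⟨by linarith, by linarith [hΛ _ (le_max_left Λ 0)]⟩)
  exact ⟨l, hl.1, he⟩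

end Coeffs

/-! ### The energy identity. -/

namespace Coeffs

variable (D : Coeffs) (x : ℤˣ → ℝ) (θ₀ : ℝ)

/-- Multiplying the equation by `part τ u` and integrating gives a positive Dirichlet energy. -/
lemma mul_incr_pos (hθ : Real.sin θ₀ = 0) {k : ℕ} (hk : k ≠ 0)
    (hφ : D.angle x θ₀ D.T₂ = θ₀ + k * Real.pi) (τ : ℤˣ) : 0 < x τ * D.incr x x θ₀ τ := by
  have hcθ := D.continuous_angleExt x θ₀
  have hcR := D.continuous_radius x θ₀
  set U : ℝ → ℝ := fun t => D.radius x θ₀ t * Real.cos (D.angleExt x θ₀ t) with hU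
  set V : ℝ → ℝ := fun t => -(D.radius x θ₀ t * Real.sin (D.angleExt x θ₀ t)) with hV
  have hUc : Continuous U := hcR.mul (Real.continuous_cos.comp hcθ)
  have hVc : Continuous V := (hcR.mul (Real.continuous_sin.comp hcθ)).neg
  have hUeq : ∀ t ∈ Icc D.T₁ D.T₂, U t = D.sol x θ₀ t := fun t ht => by
    simp only [hU, D.angleExt_of_mem x θ₀ ht, sol]
  have hVeq : ∀ t ∈ Icc D.T₁ D.T₂, V t = D.mom x θ₀ t := fun t ht => by
    simp only [hV, D.angleExt_of_mem x θ₀ ht, mom]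
  have hUd : ∀ t ∈ Ioo D.T₁ D.T₂, HasDerivAt U (D.α t * V t) t := fun t ht => by
    have h1 := D.hasDerivAt_sol x θ₀ (Ioo_subset_Icc_self ht)
    rw [← hVeq t (Ioo_subset_Icc_self ht)] at h1
    refine h1.congr_of_eventuallyEq ?_
    filter_upwards [Icc_mem_nhds ht.1 ht.2] with s hs using hUeq s hs
  have hVd : ∀ t ∈ Ioo D.T₁ D.T₂, HasDerivAt V (D.q t * U t - (x 1 * D.w 1 t * part 1 (U t)
      - x (-1) * D.w (-1) t * part (-1) (U t))) t := fun t ht => by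
    have h1 := D.hasDerivAt_mom x θ₀ (Ioo_subset_Icc_self ht)
    rw [← hUeq t (Ioo_subset_Icc_self ht)] at h1
    refine h1.congr_of_eventuallyEq ?_
    filter_upwards [Icc_mem_nhds ht.1 ht.2] with s hs using hVeq s hs
  have hV1 : V D.T₁ = 0 := by rw [hVeq _ D.left_mem, mom, D.angle_left, hθ]; simp
  have hV2 : V D.T₂ = 0 := by
    rw [hVeq _ D.right_mem, mom, hφ, Real.sin_add_nat_mul_pi, hθ]; simp
  obtain ⟨k', hkk', hcard⟩ := D.encard_zeros x θ₀ hθ (j := k) (by push_cast; exact hφ)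
  obtain rfl : k = k' := by exact_mod_cast hkk'
  set Z := {t ∈ Ioo D.T₁ D.T₂ | Real.cos (D.angle x θ₀ t) = 0} with hZ
  have hZfin : Z.Finite := Set.finite_of_encard_eq_coe hcard
  obtain ⟨z, hz, hz0⟩ : Z.Nonempty := by
    rw [← Set.encard_ne_zero, hcard]; exact_mod_cast hk
  have hO : IsOpen {t | 0 < sgn τ * U t} := isOpen_lt continuous_const (hUc.const_mul _)
  set e : ℝ → ℝ := fun t => D.α t * V t ^ 2 + D.q t * U t ^ 2 with he
  set g : ℝ → ℝ := {t | 0 < sgn τ * U t}.indicator e with hg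
  have hec : Continuous e := by
    have := D.continuous_α
    have := D.continuous_q
    fun_prop
  have hgi : IntervalIntegrable g volume D.T₁ D.T₂ := by
    rw [intervalIntegrable_iff]
    exact (hec.integrableOn_uIoc).indicator hO.measurableSet
  have hPc : Continuous fun t => part τ (U t) := (continuous_part τ).comp hUc
  have hhc : Continuous fun t => D.w τ t * part τ (U t) ^ 2 := (D.continuous_w τ).mul (hPc.pow 2)
  -- The kernel of `incr` is the squared radius, which turns the squared part of the cosine into
  -- that of the solution.
  have hincr : D.incr x x θ₀ τ = ∫ t in D.T₁..D.T₂, D.w τ t * part τ (U t) ^ 2 := by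
    unfold incr
    congr 1
    ext t
    simp only [hU]
    rw [part_mul_of_nonneg (D.radius_pos x θ₀ t).le]
    have : Real.exp (∫ r in t..D.T₂, D.slope x x θ₀ r) = D.radius x θ₀ t ^ 2 := by
      rw [radius, sq, ← Real.exp_add, add_halves]
    rw [this, cosSq]
    ring
  -- The product of the momentum and the part of `U` may fail to be differentiable at the finitely
  -- many zeros, hence the version with a countable exceptional set. The boundary terms vanish by
  -- the Neumann conditions.
  have hFTC := integral_eq_of_hasDerivAt_off_countable_of_le
    (fun t => sgn τ * V t * part τ (U t))
    (fun t => g t - x τ * (D.w τ t * part τ (U t) ^ 2)) D.lt.le hZfin.countable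
    ((hVc.const_mul _).mul hPc).continuousOn
    (by
      rintro t ⟨ht, htZ⟩
      have hU0 : U t ≠ 0 := fun h0 => htZ ⟨ht, by
        rw [hUeq t (Ioo_subset_Icc_self ht), sol] at h0
        exact (mul_eq_zero.1 h0).resolve_left (D.radius_pos x θ₀ t).ne'⟩
      have hsU : sgn τ * U t ≠ 0 := by
        refine mul_ne_zero (fun h => ?_) hU0
        have := sgn_mul_self τ
        rw [h] at this; norm_num at this
      rcases hsU.lt_or_gt with hneg | hpos
      · have h1 : g t = 0 := indicator_of_notMem (by simpa using hneg.le) _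
        rw [h1, part_of_nonpos hneg.le]
        have h2 : (fun t => sgn τ * V t * part τ (U t)) =ᶠ[𝓝 t] fun _ => 0 := by
          filter_upwards [(hUc.const_mul (sgn τ)).continuousAt.eventually_lt continuousAt_const hneg]
            with s hs
          rw [part_of_nonpos (le_of_lt hs), mul_zero]
        simpa using (hasDerivAt_const t (0 : ℝ)).congr_of_eventuallyEq h2
      · have h1 : g t = e t := indicator_of_mem (show t ∈ {t | 0 < sgn τ * U t} from hpos) _
        have hss : ∀ y : ℝ, sgn τ * (sgn τ * y) = y := fun y => by
          rw [← mul_assoc, sgn_mul_self, one_mul]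
        have h2 : (fun t => sgn τ * V t * part τ (U t)) =ᶠ[𝓝 t] fun t => V t * U t := by
          filter_upwards [continuousAt_const.eventually_lt (hUc.const_mul (sgn τ)).continuousAt hpos]
            with s hs
          rw [part_of_nonneg (le_of_lt hs), mul_comm (sgn τ), mul_assoc, hss]
        refine HasDerivAt.congr_of_eventuallyEq ?_ h2
        refine ((hVd t ht).mul (hUd t ht)).congr_deriv ?_
        rw [h1, he]
        rcases Int.units_eq_one_or τ with rfl | rfl
        · rw [sgn_one, one_mul] at hpos
          rw [part_of_nonneg (τ := 1) (by rw [sgn_one]; linarith),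
            part_of_nonpos (τ := -1) (by rw [sgn_neg_one]; linarith), sgn_one]
          ring
        · rw [sgn_neg_one] at hpos
          rw [part_of_nonneg (τ := -1) (by rw [sgn_neg_one]; linarith),
            part_of_nonpos (τ := 1) (by rw [sgn_one]; linarith), sgn_neg_one]
          ring)
    (hgi.sub ((hhc.const_mul (x τ)).intervalIntegrable _ _))
  rw [intervalIntegral.integral_sub hgi ((hhc.const_mul (x τ)).intervalIntegrable _ _),
    intervalIntegral.integral_const_mul, ← hincr, hV1, hV2] at hFTC
  have heq : x τ * D.incr x x θ₀ τ = ∫ t in D.T₁..D.T₂, g t := by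
    simp only [mul_zero, zero_mul, sub_self] at hFTC; linarith
  rw [heq]
  have hg0 : 0 ≤ g := fun t => indicator_nonneg (fun s _ => by
    have := (D.α_pos s).le
    have := D.q_nonneg s
    positivity) t
  rw [intervalIntegral.integral_pos_iff_support_of_nonneg_ae (Eventually.of_forall hg0) hgi]
  refine ⟨D.lt, ?_⟩
  have hOpen : IsOpen ({t | 0 < sgn τ * U t} ∩ {t | V t ≠ 0} ∩ Ioo D.T₁ D.T₂) :=
    (hO.inter (isOpen_ne_fun hVc continuous_const)).inter isOpen_Ioo
  have hsub : {t | 0 < sgn τ * U t} ∩ {t | V t ≠ 0} ∩ Ioo D.T₁ D.T₂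
      ⊆ Function.support g ∩ Ioc D.T₁ D.T₂ := by
    rintro t ⟨⟨h1, h2⟩, h3⟩
    refine ⟨?_, Ioo_subset_Ioc_self h3⟩
    rw [Function.mem_support, hg, indicator_of_mem h1]
    have h4 : 0 < D.α t * V t ^ 2 := mul_pos (D.α_pos t) (by have : V t ≠ 0 := h2; positivity)
    have h5 : 0 ≤ D.q t * U t ^ 2 := mul_nonneg (D.q_nonneg t) (sq_nonneg _)
    exact (by linarith : 0 < e t).ne'
  refine (hOpen.measure_pos volume ?_).trans_le (measure_mono hsub)
  -- Here `k ≠ 0` is needed: at an interior zero `U` crosses with `V ≠ 0`, so nearby there are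
  -- points where `U` has the sign `τ` and the energy density is positive, even if `q = 0`.
  have hzI := Ioo_subset_Icc_self hz
  have hUz : sgn τ * U z = 0 := by rw [hUeq z hzI, sol, hz0]; simp
  have hVz : V z ≠ 0 := by
    rw [hVeq z hzI, mom, neg_ne_zero]
    refine mul_ne_zero (D.radius_pos x θ₀ z).ne' fun h => ?_
    have := Real.sin_sq_add_cos_sq (D.angle x θ₀ z)
    rw [h, hz0] at this
    norm_num at this
  have hnear : ∀ᶠ t in 𝓝 z, V t ≠ 0 ∧ t ∈ Ioo D.T₁ D.T₂ :=
    (hVc.continuousAt.eventually_ne hVz).and (isOpen_Ioo.eventually_mem hz)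
  have hd : HasDerivAt (fun t => sgn τ * U t) (sgn τ * (D.α z * V z)) z := (hUd z hz).const_mul _
  have hdne : sgn τ * (D.α z * V z) ≠ 0 := by
    refine mul_ne_zero (fun h => ?_) (mul_ne_zero (D.α_pos z).ne' hVz)
    have := sgn_mul_self τ
    rw [h] at this; norm_num at this
  rw [hasDerivAt_iff_tendsto_slope] at hd
  rcases hdne.lt_or_gt with hneg | hpos
  · have h1 := (hd.mono_left (show 𝓝[<] z ≤ 𝓝[≠] z from nhdsWithin_mono z fun r hr => ne_of_lt hr)).eventually_lt_const
      hneg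
    obtain ⟨t, h1, h2, h3⟩ := (h1.and (eventually_mem_nhdsWithin.and
      (hnear.filter_mono nhdsWithin_le_nhds))).exists
    rw [slope_def_field, hUz, sub_zero] at h1
    refine ⟨t, ⟨?_, h3.1⟩, h3.2⟩
    have h4 : t - z < 0 := sub_neg.2 h2
    by_contra hcon
    exact (div_nonneg_of_nonpos (not_lt.1 hcon) h4.le).not_gt h1
  · have h1 := (hd.mono_left (show 𝓝[>] z ≤ 𝓝[≠] z from nhdsWithin_mono z fun r hr => ne_of_gt hr)).eventually_const_lt
      hpos
    obtain ⟨t, h1, h2, h3⟩ := (h1.and (eventually_mem_nhdsWithin.and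
      (hnear.filter_mono nhdsWithin_le_nhds))).exists
    rw [slope_def_field, hUz, sub_zero] at h1
    refine ⟨t, ⟨?_, h3.1⟩, h3.2⟩
    have h4 : 0 < t - z := sub_pos.2 h2
    by_contra hcon
    exact (div_nonpos_of_nonpos_of_nonneg (not_lt.1 hcon) h4.le).not_gt h1

end Coeffs

/-! ### Zero sets of functions increasing at their zeros. -/

/-- A function on the plane whose increments are `P (a' - a) + Q (b' - b)` with continuous `P` and
`Q` which are positive at the zeros in the open first quadrant; it is negative on the axes. -/
structure IncreasingAtZeros (F : ℝ × ℝ → ℝ) (P Q : ℝ × ℝ → ℝ × ℝ → ℝ) : Prop where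
  sub_eq : ∀ y z, F z - F y = (z.1 - y.1) * P y z + (z.2 - y.2) * Q y z
  continuous_left : Continuous fun v : (ℝ × ℝ) × (ℝ × ℝ) => P v.1 v.2
  continuous_right : Continuous fun v : (ℝ × ℝ) × (ℝ × ℝ) => Q v.1 v.2
  pos_left : ∀ z, 0 < z.1 → 0 < z.2 → F z = 0 → 0 < P z z
  pos_right : ∀ z, 0 < z.1 → 0 < z.2 → F z = 0 → 0 < Q z z
  neg_left : ∀ a, 0 ≤ a → F (a, 0) < 0
  neg_right : ∀ b, 0 ≤ b → F (0, b) < 0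

namespace IncreasingAtZeros

variable {F : ℝ × ℝ → ℝ} {P Q : ℝ × ℝ → ℝ × ℝ → ℝ}

lemma swap (h : IncreasingAtZeros F P Q) : IncreasingAtZeros (fun z => F z.swap)
    (fun y z => Q y.swap z.swap) (fun y z => P y.swap z.swap) where
  sub_eq y z := by rw [h.sub_eq]; simp only [Prod.fst_swap, Prod.snd_swap]; ring
  continuous_left := h.continuous_right.comp (f := fun v : (ℝ × ℝ) × (ℝ × ℝ) =>
    (v.1.swap, v.2.swap)) (by fun_prop)
  continuous_right := h.continuous_left.comp (f := fun v : (ℝ × ℝ) × (ℝ × ℝ) =>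
    (v.1.swap, v.2.swap)) (by fun_prop)
  pos_left z h1 h2 h3 := h.pos_right z.swap h2 h1 h3
  pos_right z h1 h2 h3 := h.pos_left z.swap h2 h1 h3
  neg_left a ha := h.neg_right a ha
  neg_right b hb := h.neg_left b hb

lemma continuous (h : IncreasingAtZeros F P Q) : Continuous F := by
  have h1 := h.continuous_left.comp (Continuous.prodMk_right (0 : ℝ × ℝ))
  have h2 := h.continuous_right.comp (Continuous.prodMk_right (0 : ℝ × ℝ))
  have h3 : F = fun z => F 0 + (z.1 * P 0 z + z.2 * Q 0 z) := by
    ext z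
    have := h.sub_eq 0 z
    simp only [Prod.fst_zero, Prod.snd_zero, sub_zero] at this
    linarith
  rw [h3]
  exact continuous_const.add ((continuous_fst.mul h1).add (continuous_snd.mul h2))

lemma pos_of_eq_zero (h : IncreasingAtZeros F P Q) {a b : ℝ} (ha : 0 ≤ a) (hb : 0 ≤ b)
    (h0 : F (a, b) = 0) : 0 < a ∧ 0 < b := by
  constructor
  · refine lt_of_le_of_ne ha ?_
    rintro rfl
    exact (h.neg_right b hb).ne h0
  · refine lt_of_le_of_ne hb ?_
    rintro rfl
    exact (h.neg_left a ha).ne h0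

/-- By the increment formula the partial derivative is `P` on the diagonal, positive at every zero;
to the right of a zero the function therefore stays positive. -/
lemma pos_of_lt_left (h : IncreasingAtZeros F P Q) {a a' b : ℝ} (ha : 0 < a) (hb : 0 < b)
    (h0 : F (a, b) = 0) (haa : a < a') : 0 < F (a', b) := by
  refine lt_of_deriv_pos (s := a) (t := a') (f := fun r => F (r, b))
    (f' := fun r => P (r, b) (r, b)) (fun r _ => ?_)
    (fun r hr h1 => h.pos_left (r, b) (ha.trans_le hr.1) hb h1) h0.ge haa
  rw [hasDerivAt_iff_tendsto_slope]
  have hc : Continuous fun r' => P (r, b) (r', b) :=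
    h.continuous_left.comp (f := fun r' : ℝ => ((r, b), (r', b))) (by fun_prop)
  refine ((hc.tendsto r).mono_left nhdsWithin_le_nhds).congr' ?_
  filter_upwards [self_mem_nhdsWithin] with r' hr'
  rw [slope_def_field, h.sub_eq]
  have : r' - r ≠ 0 := sub_ne_zero.2 hr'
  field_simp
  simp

lemma pos_of_lt_right (h : IncreasingAtZeros F P Q) {a b b' : ℝ} (ha : 0 < a) (hb : 0 < b)
    (h0 : F (a, b) = 0) (hbb : b < b') : 0 < F (a, b') :=
  h.swap.pos_of_lt_left hb ha h0 hbb

lemma eq_of_eq_zero (h : IncreasingAtZeros F P Q) {a b b' : ℝ} (ha : 0 < a) (hb : 0 < b)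
    (hb' : 0 < b') (h0 : F (a, b) = 0) (h0' : F (a, b') = 0) : b = b' := by
  rcases lt_trichotomy b b' with hlt | rfl | hlt
  · exact absurd h0' (h.pos_of_lt_right ha hb h0 hlt).ne'
  · rfl
  · exact absurd h0 (h.pos_of_lt_right ha hb' h0' hlt).ne'

lemma exists_between (h : IncreasingAtZeros F P Q) {a b b' : ℝ} (hb : b ≤ b') (h0 : F (a, b) < 0)
    (h1 : 0 < F (a, b')) : ∃ c ∈ Ioo b b', F (a, c) = 0 := by
  have hc : Continuous fun c => F (a, c) := h.continuous.comp (by fun_prop)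
  exact intermediate_value_Ioo hb hc.continuousOn ⟨h0, h1⟩

/-- A positive value below the zero, together with the negative value on the axis, would produce a
second zero on the same vertical line. -/
lemma neg_of_lt_right (h : IncreasingAtZeros F P Q) {a b b' : ℝ} (ha : 0 < a) (hb : 0 < b)
    (h0 : F (a, b) = 0) (hb' : 0 < b') (hbb : b' < b) : F (a, b') < 0 := by
  rcases lt_trichotomy (F (a, b')) 0 with hlt | heq | hgt
  · exact hlt
  · exact absurd (h.eq_of_eq_zero ha hb hb' h0 heq) hbb.ne'
  · obtain ⟨c, hc, hc0⟩ := h.exists_between hb'.le (h.neg_left a ha.le) hgt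
    exact absurd (h.eq_of_eq_zero ha hb hc.1 h0 hc0) (hc.2.trans hbb).ne'

/-- The strict sign change between `b - δ` and `b + δ` persists for nearby `a'`; the bound `δ ≤ b /
2` keeps the new zero off the axis. -/
lemma eventually_exists (h : IncreasingAtZeros F P Q) {a b ε : ℝ} (ha : 0 < a) (hb : 0 < b)
    (h0 : F (a, b) = 0) (hε : 0 < ε) :
    ∀ᶠ a' in 𝓝 a, 0 < a' ∧ ∃ b', 0 < b' ∧ |b' - b| < ε ∧ F (a', b') = 0 := by
  set δ := min ε (b / 2) with hδ
  have hδ0 : 0 < δ := lt_min hε (by linarith)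
  have hδb : δ ≤ b / 2 := min_le_right _ _
  have hδε : δ ≤ ε := min_le_left _ _
  have hc : ∀ b', Continuous fun a' => F (a', b') := fun b' => h.continuous.comp (by fun_prop)
  filter_upwards [lt_mem_nhds ha,
    (hc (b + δ)).continuousAt.eventually_const_lt (h.pos_of_lt_right ha hb h0 (by linarith)),
    (hc (b - δ)).continuousAt.eventually_lt_const
      (h.neg_of_lt_right ha hb h0 (by linarith : 0 < b - δ) (by linarith))] with a' h1 h2 h3
  obtain ⟨c, hc, hc0⟩ := h.exists_between (by linarith) h3 h2
  exact ⟨h1, c, by linarith [hc.1], by rw [abs_lt]; constructor <;> linarith [hc.1, hc.2], hc0⟩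

/-- The set `A` of first coordinates of zeros is open and closed upwards, hence an open half-line,
and zeros on vertical lines are unique. Dividing the increment formula along the graph by `a' - a`
gives `f' = -P / Q`, which is continuous. -/
lemma exists_function (h : IncreasingAtZeros F P Q) {a₀ b₀ : ℝ} (ha₀ : 0 ≤ a₀) (hb₀ : 0 ≤ b₀)
    (h₀ : F (a₀, b₀) = 0) : ∃ α : ℝ, 0 ≤ α ∧ ∃ f : ℝ → ℝ, ContDiffOn ℝ 1 f (Ioi α) ∧
      StrictAntiOn f (Ioi α) ∧ (∀ a, α < a → 0 < f a ∧ F (a, f a) = 0) ∧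
      ∀ a b, 0 ≤ a → 0 ≤ b → F (a, b) = 0 → α < a ∧ b = f a := by
  set A := {a | 0 < a ∧ ∃ b, 0 < b ∧ F (a, b) = 0} with hA
  have hmem : ∀ a b, 0 ≤ a → 0 ≤ b → F (a, b) = 0 → a ∈ A := fun a b ha hb h0 =>
    ⟨(h.pos_of_eq_zero ha hb h0).1, b, (h.pos_of_eq_zero ha hb h0).2, h0⟩
  have hne : A.Nonempty := ⟨a₀, hmem a₀ b₀ ha₀ hb₀ h₀⟩
  have hbdd : BddBelow A := ⟨0, fun a ha => ha.1.le⟩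
  have hup : ∀ a a' b, 0 < a → 0 < b → F (a, b) = 0 → a < a' →
      ∃ b', 0 < b' ∧ b' < b ∧ F (a', b') = 0 := fun a a' b ha hb h0 haa => by
    obtain ⟨c, hc, hc0⟩ := h.exists_between hb.le (h.neg_left a' (ha.trans haa).le)
      (h.pos_of_lt_left ha hb h0 haa)
    exact ⟨c, hc.1, hc.2, hc0⟩
  have hAI : ∀ a, a ∈ A ↔ sInf A < a := by
    refine fun a => ⟨fun ⟨ha, b, hb, h0⟩ => ?_, fun hlt => ?_⟩
    -- Zeros persist to the left of `a`, so the infimum of `A` does not belong to `A`.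
    · have hev := (h.eventually_exists ha hb h0 one_pos).filter_mono
        (nhdsWithin_le_nhds (s := Iio a))
      obtain ⟨a', ⟨h1, b', h2, -, h3⟩, h4⟩ := (hev.and eventually_mem_nhdsWithin).exists
      exact (csInf_le hbdd ⟨h1, b', h2, h3⟩).trans_lt h4
    · obtain ⟨a', ⟨ha', b, hb, h0⟩, hlt'⟩ := exists_lt_of_csInf_lt hne hlt
      obtain ⟨b', h1, -, h2⟩ := hup a' a b ha' hb h0 hlt'
      exact ⟨ha'.trans hlt', b', h1, h2⟩
  choose! f hf using fun a (ha : a ∈ A) => ha.2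
  have huniq : ∀ a b, 0 < a → 0 < b → F (a, b) = 0 → b = f a := fun a b ha hb h0 =>
    have haA := hmem a b ha.le hb.le h0
    h.eq_of_eq_zero ha hb (hf a haA).1 h0 (hf a haA).2
  have hcont : ∀ a ∈ A, ContinuousAt f a := fun a ha => by
    rw [Metric.continuousAt_iff']
    intro ε hε
    filter_upwards [h.eventually_exists ha.1 (hf a ha).1 (hf a ha).2 hε] with a' ⟨h1, b', h2, h3, h4⟩
    rw [← huniq a' b' h1 h2 h4, Real.dist_eq]
    exact h3
  have hder : ∀ a ∈ A, HasDerivAt f (-(P (a, f a) (a, f a) / Q (a, f a) (a, f a))) a := by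
    intro a ha
    rw [hasDerivAt_iff_tendsto_slope]
    have hpair : ContinuousAt (fun a' => (((a, f a), (a', f a')) : (ℝ × ℝ) × (ℝ × ℝ))) a :=
      continuousAt_const.prodMk (continuousAt_id.prodMk (hcont a ha))
    have hP : ContinuousAt (fun a' => P (a, f a) (a', f a')) a :=
      h.continuous_left.continuousAt.comp hpair
    have hQ : ContinuousAt (fun a' => Q (a, f a) (a', f a')) a :=
      h.continuous_right.continuousAt.comp hpair
    have hQ0 := h.pos_right (a, f a) ha.1 (hf a ha).1 (hf a ha).2
    have hlim := (hP.div hQ hQ0.ne').neg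
    refine (hlim.tendsto.mono_left nhdsWithin_le_nhds).congr' ?_
    have hnear : ∀ᶠ a' in 𝓝 a, a' ∈ A := by
      filter_upwards [lt_mem_nhds ((hAI a).1 ha)] with a' ha' using (hAI a').2 ha'
    filter_upwards [self_mem_nhdsWithin, nhdsWithin_le_nhds hnear,
      nhdsWithin_le_nhds (hQ.eventually_const_lt hQ0)] with a' h1 h2 h3
    have h4 := h.sub_eq (a, f a) (a', f a')
    rw [(hf a ha).2, (hf a' h2).2] at h4
    have h5 : a' - a ≠ 0 := sub_ne_zero.2 h1
    rw [slope_def_field]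
    simp only [Pi.neg_apply, Pi.div_apply]
    field_simp
    simp only at h4
    linarith
  have hud := uniqueDiffOn_Ioi (sInf A)
  refine ⟨sInf A, Real.sInf_nonneg fun a ha => ha.1.le, f, ?_, ?_, ?_, ?_⟩
  · rw [contDiffOn_one_iff_derivWithin hud]
    refine ⟨fun a ha => (hder a ((hAI a).2 ha)).differentiableAt.differentiableWithinAt, ?_⟩
    refine ContinuousOn.congr (f := fun a => -(P (a, f a) (a, f a) / Q (a, f a) (a, f a))) ?_
      fun a ha => (hder a ((hAI a).2 ha)).hasDerivWithinAt.derivWithin (hud a ha)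
    intro a ha
    have haA := (hAI a).2 ha
    have hpair : ContinuousAt (fun a' => (((a', f a'), (a', f a')) : (ℝ × ℝ) × (ℝ × ℝ))) a :=
      (continuousAt_id.prodMk (hcont a haA)).prodMk (continuousAt_id.prodMk (hcont a haA))
    have hP : ContinuousAt (fun a' => P (a', f a') (a', f a')) a :=
      h.continuous_left.continuousAt.comp hpair
    have hQ : ContinuousAt (fun a' => Q (a', f a') (a', f a')) a :=
      h.continuous_right.continuousAt.comp hpair
    exact (hP.div hQ (h.pos_right (a, f a) haA.1 (hf a haA).1
      (hf a haA).2).ne').neg.continuousWithinAt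
  · intro a ha a' ha' haa
    have haA := (hAI a).2 ha
    obtain ⟨b', h1, h2, h3⟩ := hup a a' (f a) haA.1 (hf a haA).1 (hf a haA).2 haa
    rwa [← huniq a' b' (haA.1.trans haa) h1 h3]
  · exact fun a ha => hf a ((hAI a).2 ha)
  · intro a b ha hb h0
    have hp := h.pos_of_eq_zero ha hb h0
    exact ⟨(hAI a).1 (hmem a b ha hb h0), huniq a b hp.1 hp.2 h0⟩

/-- The inverse `g` is the function obtained after swapping the coordinates; uniqueness of zeros on
vertical and on horizontal lines makes `f` and `g` mutually inverse between the two half-lines. -/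
lemma isHyperbolicLike (h : IncreasingAtZeros F P Q) (ε₁ ε₂ : ℤˣ) {S : Set (ℝ × ℝ)}
    (hS : ∀ z, z ∈ S ↔ 0 ≤ sgn ε₁ * z.1 ∧ 0 ≤ sgn ε₂ * z.2 ∧ F (sgn ε₁ * z.1, sgn ε₂ * z.2) = 0)
    (hne : S.Nonempty) : IsHyperbolicLike ε₁ ε₂ S := by
  obtain ⟨z, hz⟩ := hne
  obtain ⟨h1, h2, h3⟩ := (hS z).1 hz
  obtain ⟨α, hα, f, hfc, hfa, hf0, hfu⟩ := h.exists_function h1 h2 h3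
  obtain ⟨β, hβ, g, hgc, hga, hg0, hgu⟩ := h.swap.exists_function h2 h1 h3
  have hfg : ∀ a, α < a → β < f a ∧ a = g (f a) := fun a ha =>
    hgu (f a) a (hf0 a ha).1.le (hα.trans ha.le) (hf0 a ha).2
  have hgf : ∀ b, β < b → α < g b ∧ b = f (g b) := fun b hb =>
    hfu (g b) b (hg0 b hb).1.le (hβ.trans hb.le) (hg0 b hb).2
  refine ⟨α, β, hα, hβ, f, g, hfc, hgc, fun a ha => (hfg a ha).1, fun b hb => (hgf b hb).1,
    ⟨fun a ha => (hfg a ha).2.symm, fun b hb => (hgf b hb).2.symm⟩, hfa, ?_⟩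
  ext y
  rw [hS]
  constructor
  · rintro ⟨h4, h5, h6⟩
    exact hfu _ _ h4 h5 h6
  · rintro ⟨h4, h5⟩
    rw [h5]
    exact ⟨hα.trans h4.le, (hf0 _ h4).1.le, (hf0 _ h4).2⟩

end IncreasingAtZeros

/-! ### Return to the boundary value problem. -/

lemma Alternates.exists_pos {T₁ T₂ : ℝ} {W : ℤˣ → ℝ → ℝ} {k : ℕ} {σ : ℤˣ} {t : ℝ} (hk : k ≠ 0)
    (h : Alternates T₁ T₂ W k σ t) (τ : ℤˣ) : ∃ r, 0 < W τ r := by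
  obtain ⟨k, rfl⟩ := Nat.exists_eq_succ_of_ne_zero hk
  obtain ⟨h, s, -, h'⟩ := h
  rcases Int.units_eq_one_or (τ * σ) with hτ | hτ
  · obtain rfl : τ = σ := by rw [← mul_one τ, ← Int.units_mul_self σ, ← mul_assoc, hτ, one_mul]
    exact ⟨t, h.2⟩
  · obtain rfl : τ = -σ := by
      rw [← mul_one τ, ← Int.units_mul_self σ, ← mul_assoc, hτ, neg_one_mul]
    exact ⟨s, h'.mem_and_pos.2⟩

/-- The function on `{1, -1}` with the values `a` and `b`. -/
def pair {β : Type*} (a b : β) (τ : ℤˣ) : β := if τ = 1 then a else b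

lemma pair_one {β : Type*} (a b : β) : pair a b 1 = a := if_pos rfl

lemma pair_neg_one {β : Type*} (a b : β) : pair a b (-1) = b := if_neg (by decide)

lemma forall_pair {β : Type*} {a b : β} {p : β → Prop} (ha : p a) (hb : p b) (τ : ℤˣ) :
    p (pair a b τ) := by
  unfold pair; split_ifs <;> assumption

lemma continuous_pair : Continuous fun z : ℝ × ℝ => pair z.1 z.2 := by
  refine continuous_pi fun τ => ?_
  unfold pair
  split_ifs
  exacts [continuous_fst, continuous_snd]

namespace Coeffs

variable (D : Coeffs)

/-- A gain of `k π` with `k ≠ 0` needs points where each of the two weighted terms is positive,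
which a zero parameter forbids. The segment from `0` to `x` reduces the inequality to the case of an
exact gain. -/
lemma angle_lt_of_eq_zero {x : ℤˣ → ℝ} {τ : ℤˣ} (hx : x τ = 0) (σ : ℤˣ) {k : ℕ} (hk : k ≠ 0) :
    D.angle x (startAngle σ) D.T₂ < startAngle σ + k * Real.pi := by
  have hpi := Real.pi_pos
  have hkpi : 0 < k * Real.pi := mul_pos (Nat.cast_pos.2 (Nat.pos_of_ne_zero hk)) hpi
  have hc : Continuous fun l : ℝ => D.angle (l • x) (startAngle σ) D.T₂ :=
    (D.continuous_angle_right (startAngle σ)).comp (by fun_prop)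
  have h0 : D.angle ((0 : ℝ) • x) (startAngle σ) D.T₂ ≤ startAngle σ := by
    rw [zero_smul]; exact D.angle_zero_le _ (sin_startAngle σ)
  by_contra! hcon
  obtain ⟨l, -, hl⟩ := intermediate_value_Icc zero_le_one hc.continuousOn
    (show startAngle σ + k * Real.pi ∈ Icc _ _ from ⟨by linarith, by simpa using hcon⟩)
  obtain ⟨y, -, hy⟩ := D.exists_alternates (l • x) σ k D.T₂ D.right_mem (Or.inr ⟨hk, hl.symm⟩)
  obtain ⟨r, hr⟩ := hy.exists_pos hk τ
  simp [hx] at hr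

lemma increasingAtZeros (σ : ℤˣ) {k : ℕ} (hk : k ≠ 0) : IncreasingAtZeros
    (fun z => D.angle (pair z.1 z.2) (startAngle σ) D.T₂ - (startAngle σ + k * Real.pi))
    (fun y z => D.incr (pair y.1 y.2) (pair z.1 z.2) (startAngle σ) 1)
    (fun y z => D.incr (pair y.1 y.2) (pair z.1 z.2) (startAngle σ) (-1)) where
  sub_eq y z := by
    have := D.angle_sub_angle (pair y.1 y.2) (pair z.1 z.2) (startAngle σ)
    simp only [pair_one, pair_neg_one] at this
    linarith
  continuous_left := (D.continuous_incr (startAngle σ) 1).comp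
    (f := fun v : (ℝ × ℝ) × (ℝ × ℝ) => (pair v.1.1 v.1.2, pair v.2.1 v.2.2))
    ((continuous_pair.comp continuous_fst).prodMk (continuous_pair.comp continuous_snd))
  continuous_right := (D.continuous_incr (startAngle σ) (-1)).comp
    (f := fun v : (ℝ × ℝ) × (ℝ × ℝ) => (pair v.1.1 v.1.2, pair v.2.1 v.2.2))
    ((continuous_pair.comp continuous_fst).prodMk (continuous_pair.comp continuous_snd))
  pos_left z h1 h2 h3 := by
    have := D.mul_incr_pos (pair z.1 z.2) _ (sin_startAngle σ) hk (sub_eq_zero.1 h3) 1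
    rw [pair_one] at this
    exact pos_of_mul_pos_right this h1.le
  pos_right z h1 h2 h3 := by
    have := D.mul_incr_pos (pair z.1 z.2) _ (sin_startAngle σ) hk (sub_eq_zero.1 h3) (-1)
    rw [pair_neg_one] at this
    exact pos_of_mul_pos_right this h2.le
  neg_left a _ := sub_neg.2 (D.angle_lt_of_eq_zero (τ := -1) (pair_neg_one _ _) σ hk)
  neg_right b _ := sub_neg.2 (D.angle_lt_of_eq_zero (τ := 1) (pair_one _ _) σ hk)

/-- The extended coefficients of the problem, with the signs of the weights adapted to the
quadrant. -/
def ofFunctions {T₁ T₂ : ℝ} (hT : T₁ < T₂) {p q m n : ℝ → ℝ}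
    (hp : ContinuousOn p (Icc T₁ T₂)) (hq : ContinuousOn q (Icc T₁ T₂))
    (hm : ContinuousOn m (Icc T₁ T₂)) (hn : ContinuousOn n (Icc T₁ T₂))
    (hp_pos : ∀ t ∈ Icc T₁ T₂, 0 < p t) (hq_nonneg : ∀ t ∈ Icc T₁ T₂, 0 ≤ q t) (ε₁ ε₂ : ℤˣ) :
    Coeffs where
  T₁ := T₁
  T₂ := T₂
  α t := (p (projIcc T₁ T₂ hT.le t))⁻¹
  q t := q (projIcc T₁ T₂ hT.le t)
  w τ t := pair (sgn ε₁ * m (projIcc T₁ T₂ hT.le t)) (sgn ε₂ * n (projIcc T₁ T₂ hT.le t)) τ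
  lt := hT
  continuous_α := (continuousOn_iff_continuous_domRestrict.1 hp).Icc_extend'.inv₀
    fun t => (hp_pos _ (projIcc T₁ T₂ hT.le t).2).ne'
  continuous_q := (continuousOn_iff_continuous_domRestrict.1 hq).Icc_extend'
  continuous_w τ := by
    have h1 := (continuousOn_iff_continuous_domRestrict.1 hm).Icc_extend' (h := hT.le)
    have h2 := (continuousOn_iff_continuous_domRestrict.1 hn).Icc_extend' (h := hT.le)
    unfold pair
    split_ifs
    exacts [h1.const_mul _, h2.const_mul _]
  α_pos t := inv_pos.2 (hp_pos _ (projIcc T₁ T₂ hT.le t).2)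
  q_nonneg t := hq_nonneg _ (projIcc T₁ T₂ hT.le t).2

end Coeffs

section

variable {T₁ T₂ : ℝ} (hT : T₁ < T₂) {p q m n : ℝ → ℝ}
    (hp : ContinuousOn p (Icc T₁ T₂)) (hq : ContinuousOn q (Icc T₁ T₂))
    (hm : ContinuousOn m (Icc T₁ T₂)) (hn : ContinuousOn n (Icc T₁ T₂))
    (hp_pos : ∀ t ∈ Icc T₁ T₂, 0 < p t) (hq_nonneg : ∀ t ∈ Icc T₁ T₂, 0 ≤ q t) (ε₁ ε₂ : ℤˣ)

/-- Parameters and weights are both multiplied by the signs of the quadrant, so their products, and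
hence the equation, do not change. -/
lemma mem_C_inter_quadrant_iff (k : ℕ) (σ : ℤˣ) (z : ℝ × ℝ) :
    z ∈ C T₁ T₂ p q m n k σ ∩ quadrant ε₁ ε₂ ↔ 0 ≤ sgn ε₁ * z.1 ∧ 0 ≤ sgn ε₂ * z.2 ∧
      (Coeffs.ofFunctions hT hp hq hm hn hp_pos hq_nonneg ε₁ ε₂).angle
          (pair (sgn ε₁ * z.1) (sgn ε₂ * z.2)) (startAngle (σ * (-1) ^ k)) T₂
        - (startAngle (σ * (-1) ^ k) + k * Real.pi) = 0 := by
  have hsgn : ∀ (ε : ℤˣ) (a b : ℝ), sgn ε * a * (sgn ε * b) = a * b := fun ε a b => by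
    rw [mul_mul_mul_comm, sgn_mul_self, one_mul]
  have h := mem_C_iff (Coeffs.ofFunctions hT hp hq hm hn hp_pos hq_nonneg ε₁ ε₂)
    (pair (sgn ε₁ * z.1) (sgn ε₂ * z.2)) (p := p) (q := q) (m := m) (n := n) (a := z.1) (b := z.2)
    (fun t (ht : t ∈ Icc T₁ T₂) => by
      simp only [Coeffs.ofFunctions, projIcc_of_mem _ ht]
      exact inv_mul_cancel₀ (hp_pos t ht).ne')
    (fun t (ht : t ∈ Icc T₁ T₂) => by simp only [Coeffs.ofFunctions, projIcc_of_mem _ ht])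
    (fun t (ht : t ∈ Icc T₁ T₂) => by
      simp only [Coeffs.ofFunctions, projIcc_of_mem _ ht, pair_one, hsgn])
    (fun t (ht : t ∈ Icc T₁ T₂) => by
      simp only [Coeffs.ofFunctions, projIcc_of_mem _ ht, pair_neg_one, hsgn]) k σ
  rw [mem_inter_iff, sub_eq_zero]
  change (z.1, z.2) ∈ C T₁ T₂ p q m n k σ ∧ (_ ∧ _) ↔ _
  rw [show (z.1, z.2) ∈ C T₁ T₂ p q m n k σ ↔ _ from h]
  exact ⟨fun h => ⟨h.2.1, h.2.2, h.1⟩, fun h => ⟨h.2.2, h.1, h.2.1⟩⟩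

lemma exists_alternates_zero (hmε : PartNonzero T₁ T₂ m ε₁) (hnε : PartNonzero T₁ T₂ n ε₂)
    (σ : ℤˣ) : ∃ t, Alternates T₁ T₂
      (Coeffs.ofFunctions hT hp hq hm hn hp_pos hq_nonneg ε₁ ε₂).w 0 σ t := by
  set D := Coeffs.ofFunctions hT hp hq hm hn hp_pos hq_nonneg ε₁ ε₂ with hD
  obtain ⟨t, ht, hpos⟩ : ∃ t ∈ Icc T₁ T₂, 0 < D.w σ t := by
    have haux : ∀ ε y, part ε y ≠ 0 → 0 < sgn ε * y := fun ε y h => by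
      by_contra hcon
      exact h (part_of_nonpos (not_lt.1 hcon))
    rcases Int.units_eq_one_or σ with rfl | rfl
    · obtain ⟨t, ht, h⟩ := hmε
      refine ⟨t, ht, ?_⟩
      simp only [hD, Coeffs.ofFunctions, projIcc_of_mem _ ht, pair_one]
      exact haux _ _ h
    · obtain ⟨t, ht, h⟩ := hnε
      refine ⟨t, ht, ?_⟩
      simp only [hD, Coeffs.ofFunctions, projIcc_of_mem _ ht, pair_neg_one]
      exact haux _ _ h
  rw [← closure_Ioo hT.ne] at ht
  obtain ⟨r, h1, h2⟩ := mem_closure_iff.1 ht {r | 0 < D.w σ r}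
    (isOpen_lt continuous_const (D.continuous_w σ)) hpos
  exact ⟨r, h2, h1⟩

/-- A gain of `k π` yields a chain for the products `x τ * w τ`, and `x ≥ 0` passes it on to the
weights. For `k = 0` the gain gives no information, and the chain comes from the nonvanishing of the
parts. -/
lemma meets_iff (hmε : PartNonzero T₁ T₂ m ε₁) (hnε : PartNonzero T₁ T₂ n ε₂) (k : ℕ) (σ : ℤˣ) :
    Meets T₁ T₂ p q m n ε₁ ε₂ k σ ↔ ∃ t, Alternates T₁ T₂
      (Coeffs.ofFunctions hT hp hq hm hn hp_pos hq_nonneg ε₁ ε₂).w k σ t := by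
  have hsign : σ * (-1) ^ k * (-1) ^ k = σ := by rw [mul_assoc, Int.units_mul_self, mul_one]
  have hmem := mem_C_inter_quadrant_iff hT hp hq hm hn hp_pos hq_nonneg ε₁ ε₂ k σ
  constructor
  · rintro ⟨z, hz⟩
    obtain ⟨h1, h2, h3⟩ := (hmem z).1 hz
    rcases eq_or_ne k 0 with rfl | hk
    · exact exists_alternates_zero hT hp hq hm hn hp_pos hq_nonneg ε₁ ε₂ hmε hnε σ
    · obtain ⟨y, -, hy⟩ := Coeffs.exists_alternates _ _ _ k T₂ (Coeffs.right_mem _)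
        (Or.inr ⟨hk, (sub_eq_zero.1 h3).symm⟩)
      rw [hsign] at hy
      exact ⟨y, hy.mono fun τ t _ h => pos_of_mul_pos_right h (forall_pair h1 h2 τ)⟩
  · rintro ⟨t, ht⟩
    obtain ⟨l, hl, he⟩ := Coeffs.exists_angle_eq
      (Coeffs.ofFunctions hT hp hq hm hn hp_pos hq_nonneg ε₁ ε₂) (σ * (-1) ^ k) k (z := t)
      (by rw [hsign]; exact ht)
    refine ⟨(sgn ε₁ * l, sgn ε₂ * l), (hmem _).2 ?_⟩
    simp only [← mul_assoc, sgn_mul_self, one_mul]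
    refine ⟨hl, hl, sub_eq_zero.2 ?_⟩
    rw [← he, show pair l l = fun _ => l from funext fun τ => by simp [pair]]
    rfl

end

lemma isHyperbolicLike_of_meets {T₁ T₂ : ℝ} (hT : T₁ < T₂) {p q m n : ℝ → ℝ}
    (hp : ContinuousOn p (Icc T₁ T₂)) (hq : ContinuousOn q (Icc T₁ T₂))
    (hm : ContinuousOn m (Icc T₁ T₂)) (hn : ContinuousOn n (Icc T₁ T₂))
    (hp_pos : ∀ t ∈ Icc T₁ T₂, 0 < p t) (hq_nonneg : ∀ t ∈ Icc T₁ T₂, 0 ≤ q t) (ε₁ ε₂ : ℤˣ)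
    {k : ℕ} (hk : k ≠ 0) {σ : ℤˣ}
    (h : Meets T₁ T₂ p q m n ε₁ ε₂ k σ) :
    IsHyperbolicLike ε₁ ε₂ (C T₁ T₂ p q m n k σ ∩ quadrant ε₁ ε₂) :=
  ((Coeffs.ofFunctions hT hp hq hm hn hp_pos hq_nonneg ε₁ ε₂).increasingAtZeros
    (σ * (-1) ^ k) hk).isHyperbolicLike ε₁ ε₂
    (mem_C_inter_quadrant_iff hT hp hq hm hn hp_pos hq_nonneg ε₁ ε₂ k σ) h

/-! ### Combinatorics of the labels. -/

/-- At the first failing level `k₀ + 1` the extension property leaves exactly one sign, and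
shortening carries the failure over to both signs at all later levels. -/
lemma forall_or_exists_maximal {A : ℕ → ℤˣ → Prop} (h0 : ∀ σ, A 0 σ)
    (hdrop : ∀ k σ τ, A (k + 1) σ → A k τ)
    (hext : ∀ k, A k 1 → A k (-1) → A (k + 1) 1 ∨ A (k + 1) (-1)) :
    (∀ k, A k 1 ∧ A k (-1)) ∨ ∃ k₀, (∀ k ≤ k₀, A k 1 ∧ A k (-1)) ∧
      Xor (A (k₀ + 1) 1) (A (k₀ + 1) (-1)) ∧ ∀ k ≥ k₀ + 2, ¬ A k 1 ∧ ¬ A k (-1) := by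
  by_cases hall : ∀ k, A k 1 ∧ A k (-1)
  · exact Or.inl hall
  · right
    push Not at hall
    have hex : ∃ k, ¬ (A k 1 ∧ A k (-1)) := by
      obtain ⟨k, hk⟩ := hall
      exact ⟨k, fun h => hk h.1 h.2⟩
    classical
    obtain ⟨K, hK, hmin⟩ : ∃ K, ¬ (A K 1 ∧ A K (-1)) ∧ ∀ k < K, A k 1 ∧ A k (-1) :=
      ⟨Nat.find hex, Nat.find_spec hex, fun k hk => not_not.1 (Nat.find_min hex hk)⟩
    obtain ⟨k₀, rfl⟩ := Nat.exists_eq_succ_of_ne_zero (show K ≠ 0 by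
      rintro rfl; exact hK ⟨h0 1, h0 (-1)⟩)
    refine ⟨k₀, fun k hk => hmin k (Nat.lt_succ_of_le hk), ?_, ?_⟩
    · have h1 := hmin k₀ (Nat.lt_succ_self _)
      rcases hext k₀ h1.1 h1.2 with h | h
      · exact Or.inl ⟨h, fun h' => hK ⟨h, h'⟩⟩
      · exact Or.inr ⟨h, fun h' => hK ⟨h', h⟩⟩
    · have key : ∀ k ≥ k₀ + 2, ∀ σ, ¬ A k σ := by
        intro k hk
        induction k, hk using Nat.le_induction with
        | base => exact fun σ h => hK ⟨hdrop _ _ _ h, hdrop _ _ _ h⟩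
        | succ k _ ih => exact fun σ h => ih σ (hdrop _ _ _ h)
      exact fun k hk => ⟨key k hk _, key k hk _⟩

/-- The levels `1, …, k₀` contribute both signs and the level `k₀ + 1` one, so there are `2 k₀ + 1`
labels. -/
lemma infinite_or_odd_ncard {A : ℕ → ℤˣ → Prop} (h : (∀ k, A k 1 ∧ A k (-1)) ∨
    ∃ k₀, (∀ k ≤ k₀, A k 1 ∧ A k (-1)) ∧ Xor (A (k₀ + 1) 1) (A (k₀ + 1) (-1)) ∧
      ∀ k ≥ k₀ + 2, ¬ A k 1 ∧ ¬ A k (-1)) :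
    {i : ℕ × ℤˣ | 1 ≤ i.1 ∧ A i.1 i.2}.Infinite ∨
      {i : ℕ × ℤˣ | 1 ≤ i.1 ∧ A i.1 i.2}.Finite ∧
        Odd {i : ℕ × ℤˣ | 1 ≤ i.1 ∧ A i.1 i.2}.ncard := by
  rcases h with h | ⟨k₀, h1, h2, h3⟩
  · left
    refine Set.infinite_of_injective_forall_mem (f := fun k : ℕ => (k + 1, (1 : ℤˣ)))
      (fun a b hab => by simpa using hab) fun k => ⟨Nat.le_add_left 1 k, (h (k + 1)).1⟩
  · right
    obtain ⟨τ, hτ, hτ'⟩ : ∃ τ, A (k₀ + 1) τ ∧ ∀ σ, A (k₀ + 1) σ → σ = τ := by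
      rcases h2 with ⟨h, h'⟩ | ⟨h, h'⟩
      · refine ⟨1, h, fun σ hσ => (Int.units_eq_one_or σ).resolve_right ?_⟩
        rintro rfl; exact h' hσ
      · refine ⟨-1, h, fun σ hσ => (Int.units_eq_one_or σ).resolve_left ?_⟩
        rintro rfl; exact h' hσ
    have heq : {i : ℕ × ℤˣ | 1 ≤ i.1 ∧ A i.1 i.2}
        = ((insert (k₀ + 1, τ) (Finset.Icc 1 k₀ ×ˢ (Finset.univ : Finset ℤˣ)) :
          Finset (ℕ × ℤˣ)) : Set (ℕ × ℤˣ)) := by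
      ext ⟨k, σ⟩
      simp only [mem_ofPred_eq, Finset.coe_insert, Finset.coe_product, Finset.coe_Icc,
        Finset.coe_univ, mem_insert_iff, Prod.mk.injEq, mem_prod, mem_Icc, mem_univ, and_true]
      constructor
      · rintro ⟨hk, hA⟩
        rcases lt_trichotomy k (k₀ + 1) with hlt | rfl | hgt
        · exact Or.inr ⟨hk, by omega⟩
        · exact Or.inl ⟨rfl, hτ' σ hA⟩
        · have := h3 k (by omega)
          rcases Int.units_eq_one_or σ with rfl | rfl
          exacts [absurd hA this.1, absurd hA this.2]
      · rintro (⟨rfl, rfl⟩ | ⟨hk, hk'⟩)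
        · exact ⟨by omega, hτ⟩
        · refine ⟨hk, ?_⟩
          rcases Int.units_eq_one_or σ with rfl | rfl
          exacts [(h1 k hk').1, (h1 k hk').2]
    rw [heq]
    refine ⟨Finset.finite_toSet _, ?_⟩
    rw [Set.ncard_coe_finset, Finset.card_insert_of_notMem (by simp), Finset.card_product,
      Nat.card_Icc, Finset.card_univ, Fintype.card_units_int]
    exact ⟨k₀, by omega⟩

end Fucik

end

/-! ### The main theorem. -/

theorem mainTheorem2 (T₁ T₂ : ℝ) (hT : T₁ < T₂) (p q m n : ℝ → ℝ)
    (hp : ContinuousOn p (Icc T₁ T₂)) (hq : ContinuousOn q (Icc T₁ T₂))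
    (hm : ContinuousOn m (Icc T₁ T₂)) (hn : ContinuousOn n (Icc T₁ T₂))
    (hp_pos : ∀ t ∈ Icc T₁ T₂, 0 < p t) (hq_nonneg : ∀ t ∈ Icc T₁ T₂, 0 ≤ q t) :
    (∀ ε₁ ε₂ : ℤˣ, Fucik.PartNonzero T₁ T₂ m ε₁ → Fucik.PartNonzero T₁ T₂ n ε₂ →
      (∀ k : ℕ, Fucik.Meets T₁ T₂ p q m n ε₁ ε₂ k 1 ∧
          Fucik.Meets T₁ T₂ p q m n ε₁ ε₂ k (-1)) ∨
      (∃ k₀ : ℕ,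
        (∀ k ≤ k₀, Fucik.Meets T₁ T₂ p q m n ε₁ ε₂ k 1 ∧
          Fucik.Meets T₁ T₂ p q m n ε₁ ε₂ k (-1)) ∧
        Xor (Fucik.Meets T₁ T₂ p q m n ε₁ ε₂ (k₀ + 1) 1)
          (Fucik.Meets T₁ T₂ p q m n ε₁ ε₂ (k₀ + 1) (-1)) ∧
        (∀ k ≥ k₀ + 2, ¬ Fucik.Meets T₁ T₂ p q m n ε₁ ε₂ k 1 ∧
          ¬ Fucik.Meets T₁ T₂ p q m n ε₁ ε₂ k (-1)))) ∧
    (Fucik.ChangesSign T₁ T₂ m → Fucik.ChangesSign T₁ T₂ n → ∀ ε₁ ε₂ : ℤˣ,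
      (Fucik.SigmaStar T₁ T₂ p q m n ∩ Fucik.quadrant ε₁ ε₂ =
        ⋃ i ∈ Fucik.curveLabels T₁ T₂ p q m n ε₁ ε₂,
          (Fucik.C T₁ T₂ p q m n i.1 i.2 ∩ Fucik.quadrant ε₁ ε₂)) ∧
      (∀ i ∈ Fucik.curveLabels T₁ T₂ p q m n ε₁ ε₂,
        Fucik.IsHyperbolicLike ε₁ ε₂
          (Fucik.C T₁ T₂ p q m n i.1 i.2 ∩ Fucik.quadrant ε₁ ε₂)) ∧
      ((Fucik.curveLabels T₁ T₂ p q m n ε₁ ε₂).Infinite ∨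
        ((Fucik.curveLabels T₁ T₂ p q m n ε₁ ε₂).Finite ∧
          Odd (Fucik.curveLabels T₁ T₂ p q m n ε₁ ε₂).ncard))) := by
  have hdich : ∀ ε₁ ε₂ : ℤˣ, Fucik.PartNonzero T₁ T₂ m ε₁ → Fucik.PartNonzero T₁ T₂ n ε₂ → _ :=
    fun ε₁ ε₂ hmε hnε => Fucik.forall_or_exists_maximal
      (A := Fucik.Meets T₁ T₂ p q m n ε₁ ε₂)
      (fun σ => (Fucik.meets_iff hT hp hq hm hn hp_pos hq_nonneg ε₁ ε₂ hmε hnε 0 σ).2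
        (Fucik.exists_alternates_zero hT hp hq hm hn hp_pos hq_nonneg ε₁ ε₂ hmε hnε σ))
      (fun k σ τ h => by
        rw [Fucik.meets_iff hT hp hq hm hn hp_pos hq_nonneg ε₁ ε₂ hmε hnε] at h ⊢
        obtain ⟨t, ht⟩ := h
        -- For the same final sign the first point of the chain is dropped, for the opposite sign
        -- the last one.
        rcases eq_or_ne τ σ with rfl | hne
        · exact ⟨t, ht.of_succ⟩
        · obtain ⟨-, s, -, hs⟩ := ht
          obtain rfl : τ = -σ := Int.units_ne_iff_eq_neg.1 hne
          exact ⟨s, hs⟩)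
      (fun k h h' => by
        rw [Fucik.meets_iff hT hp hq hm hn hp_pos hq_nonneg ε₁ ε₂ hmε hnε] at h h' ⊢
        rw [Fucik.meets_iff hT hp hq hm hn hp_pos hq_nonneg ε₁ ε₂ hmε hnε]
        obtain ⟨t, ht⟩ := h
        obtain ⟨s, hs⟩ := h'
        exact ht.exists_succ (Fucik.Coeffs.continuous_w _) hs)
  refine ⟨hdich, fun hmc hnc ε₁ ε₂ => ⟨?_, fun i hi => ?_, ?_⟩⟩
  · ext z
    simp only [Fucik.SigmaStar, Fucik.curveLabels, mem_inter_iff, mem_iUnion, mem_union,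
      mem_ofPred_eq, exists_prop, Prod.exists, mem_Ici]
    constructor
    · rintro ⟨⟨k, hk, h | h⟩, hz⟩
      exacts [⟨k, 1, ⟨hk, z, h, hz⟩, h, hz⟩, ⟨k, -1, ⟨hk, z, h, hz⟩, h, hz⟩]
    · rintro ⟨k, σ, ⟨hk, -⟩, h, hz⟩
      refine ⟨⟨k, hk, ?_⟩, hz⟩
      rcases Int.units_eq_one_or σ with rfl | rfl
      exacts [Or.inl h, Or.inr h]
  · exact Fucik.isHyperbolicLike_of_meets hT hp hq hm hn hp_pos hq_nonneg ε₁ ε₂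
      (Nat.one_le_iff_ne_zero.1 hi.1) hi.2
  · have hε : ∀ {w : ℝ → ℝ}, Fucik.ChangesSign T₁ T₂ w → ∀ ε, Fucik.PartNonzero T₁ T₂ w ε :=
      fun h ε => by
        rcases Int.units_eq_one_or ε with rfl | rfl
        exacts [h.1, h.2]
    exact Fucik.infinite_or_odd_ncard (hdich ε₁ ε₂ (hε hmc ε₁) (hε hnc ε₂))
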